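/- \textbf{Definitions.} Let $\mathcal A=(Q,A,I,F,\delta)$ be an NFA over a finite alphabet $A$, with initial states $I\subseteq Q$, final states $F\subseteq Q$ and transitions $\delta\subseteq Q\times A\times Q$. For $B\subseteq A$ and $p,q\in Q$, write $p\xrightarrow{\,u\,}q$ for a path from $p$ to $q$ labeled by the word $u$, $p\xrightarrow{\subseteq B}q$ for a (possibly empty) path from $p$ to $q$ all of whose transitions are labeled by letters of $B$, and $p\xrightarrow{=B}q$ for such a path along which moreover every letter of $B$ occurs at least once. A \emph{factorization pattern} $(\vec u,\vec B)$ consists of words $\vec u=(u_0,\dots,u_p)$ in $A^*$ and nonempty subalphabets $\vec B=(B_1,\dots,B_p)$ of $A$, for some $p\ge 0$. A \emph{$(\vec u,\vec B)$-path} in $\mathcal A$ is a path from some initial state to some final state of the form $$s_0\xrightarrow{u_0}t_0\xrightarrow{\subseteq B_1}q_1\xrightarrow{=B_1}q_1\xrightarrow{\subseteq B_1}s_1\xrightarrow{u_1}t_1\;\cdots\; t_{p-1}\xrightarrow{\subseteq B_p}q_p\xrightarrow{=B_p}q_p\xrightarrow{\subseteq B_p}s_p\xrightarrow{u_p}t_p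 .$$ \textbf{Proposition.} Given two NFAs $\mathcal A_1,\mathcal A_2$ over a common finite alphabet $A$, one can decide in time polynomial in the numbers of states of $\mathcal A_1$ and $\mathcal A_2$ and in the size of $A$ whether there exists a factorization pattern $(\vec u,\vec B)$ such that both $\mathcal A_1$ and $\mathcal A_2$ admit a $(\vec u,\vec B)$-path. That is, there are a (multi-stack) Turing machine $T$ and a polynomial $f$ such that, on every such pair, given by $|A|$, $|Q_1|$, $|Q_2|$ in unary followed by the characteristic bits of the initial states, the final states and the transition table of each automaton, $T$ halts after at most $f(|Q_1|+|Q_2|+|A|)$ steps with the correct yes/no answer. -/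

import Mathlib

namespace NFA

variable {A Q : Type*}

/-- `p --⊆B--> q`: a path from `p` to `q` all of whose transitions are labeled by letters of `B`
(the empty path is allowed when `p = q`). -/
def SubsetPath (M : NFA A Q) (B : Set A) (p q : Q) : Prop :=
  ∃ w : List A, {a | a ∈ w} ⊆ B ∧ Nonempty (M.Path p q w)

/-- `p --=B--> q`: a path from `p` to `q` all of whose transitions are labeled by letters of `B`
and along which every letter of `B` occurs at least once. -/
def EqPath (M : NFA A Q) (B : Set A) (p q : Q) : Prop :=
  ∃ w : List A, {a | a ∈ w} = B ∧ Nonempty (M.Path p q w)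

end NFA

/-- A factorization pattern: words `u₀, …, u_p` and nonempty subalphabets `B₁, …, B_p`, with
`p ≥ 0` (here `B i` is the subalphabet between `u i` and `u (i + 1)`). -/
structure FactorizationPattern (A : Type*) where
  p : ℕ
  u : Fin (p + 1) → List A
  B : Fin p → Set A
  B_nonempty : ∀ i, (B i).Nonempty

/-- `M` admits a `(u, B)`-path: a path from an initial state to a final state of the form
`s₀ --u₀--> t₀ --⊆B₁--> q₁ --=B₁--> q₁ --⊆B₁--> s₁ --u₁--> t₁ ⋯ s_p --u_p--> t_p`. -/
def NFA.AdmitsPath {A Q : Type*} (M : NFA A Q) (P : FactorizationPattern A) : Prop :=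
  ∃ s t : Fin (P.p + 1) → Q,
    s 0 ∈ M.start ∧ t (Fin.last P.p) ∈ M.accept ∧
    (∀ i, Nonempty (M.Path (s i) (t i) (P.u i))) ∧
    ∀ i : Fin P.p, ∃ q : Q,
      M.SubsetPath (P.B i) (t i.castSucc) q ∧
      M.EqPath (P.B i) q q ∧
      M.SubsetPath (P.B i) q (s i.succ)

open Classical in
/-- The bits of an NFA with states `0, …, n - 1` over the alphabet `{0, …, k - 1}`: the
characteristic vectors of the initial and of the final states, then the transition table,
one bit for each triple `(p, a, q)` in lexicographic order. -/
noncomputable def encodeNFA {k n : ℕ} (M : NFA (Fin k) (Fin n)) : List Bool :=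
  (List.finRange n).map (fun q => decide (q ∈ M.start)) ++
  (List.finRange n).map (fun q => decide (q ∈ M.accept)) ++
  (List.finRange n).flatMap fun p =>
    (List.finRange k).flatMap fun a =>
      (List.finRange n).map fun q => decide (q ∈ M.step p a)

/-- The input word for a pair of NFAs over the same alphabet: the size of the alphabet and the
numbers of states in unary, each closed by `false`, then the bits of the two NFAs. -/
noncomputable def encodeNFAPair {k n₁ n₂ : ℕ} (M₁ : NFA (Fin k) (Fin n₁))
    (M₂ : NFA (Fin k) (Fin n₂)) : List Bool :=
  List.replicate k true ++ [false] ++ (List.replicate n₁ true ++ [false]) ++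
    (List.replicate n₂ true ++ [false]) ++ encodeNFA M₁ ++ encodeNFA M₂

open Classical in
/-- The answer to the decision problem: is there a factorization pattern `P` for which both NFAs
admit a path of shape `P`? -/
noncomputable def hasCommonPatternPath {A Q₁ Q₂ : Type*} (M₁ : NFA A Q₁) (M₂ : NFA A Q₂) : Bool :=
  decide (∃ P : FactorizationPattern A, M₁.AdmitsPath P ∧ M₂.AdmitsPath P)

/-! ### Monotone iterations on a finite set -/

section

open Function Relation

/-! Fix a pair `q = (q₁, q₂)` of states. A loop at `qᵢ` with label set exactly `B` exists iff every
letter of `B` lies on some loop at `qᵢ` with labels in `B`, because loops at one state can be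
concatenated (`NFA.eqPath_self_iff`). Imposed for both automata, this condition is monotone in `B`.
Hence there is a largest set `G q` that satisfies it, and this set is what remains after at most
`|A|` rounds of deleting the letters that fail (`subset_pruneIn`, `pruneIn_condition`). Every `B`
that admits loops at `q₁` and `q₂` is contained in `G q`, and enlarging `B` to `G q` preserves all
paths with labels in `B`. So each block of a common pattern may use `G q`, and no search through the
exponentially many subalphabets is needed: a common pattern exists iff a final pair is reachable
from an initial pair in a graph on `Q₁ × Q₂`, whose edges read a common letter or pass through some
`q` with `G q` nonempty (`NFA.exists_common_pattern_iff`).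

For the running time, the algorithm is written in a loop language in which no loop makes more than
`N` rounds, where `N` is the length of the input. Such a program compiles to a stack machine whose
number of steps is bounded by a polynomial in `N` read off from the syntax
(`LoopProg.simulates_compile`, `LoopProg.machine_outputs`). Relations of arity at most 3 on the
numbers below `N` are kept in bit arrays, and one round of each fixed-point iteration is a
first-order formula, evaluated by nested loops (`LoopProg.eval_comp`, `LoopProg.eval_set`). As the
alphabet and both state sets have at most `N` elements, `N` rounds suffice for pruning and for each
closure, and `N * N` rounds for the product graph (`LoopProg.spread_spec`, `LoopProg.loops_spec`,
`LoopProg.explore_spec`). -/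

theorem mem_of_step_subset_of_card_le {α : Type*} [Finite α] {f : ℕ → Set α} (hf : Monotone f)
    (hs : ∀ t, f t = f (t + 1) → f (t + 1) = f (t + 2)) {m : ℕ} (hm : Nat.card α ≤ m) :
    f (m + 1) = f m := by
  have key : (f (m + 1)).ncard = (f m).ncard := by
    -- The cardinalities are bounded by `Nat.card α`, and by `hs` they stop growing for good once
    -- they fail to grow, so they are constant from that index on.
    have (n : ℕ) := Nat.stabilises_of_monotone (n := n) (f := fun t => (f t).ncard)
      (b := Nat.card α)
      (fun a b h => Set.ncard_le_ncard (hf h)) (fun t => Set.ncard_le_card _) (fun t h => by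
        have : f t = f (t + 1) :=
          Set.eq_of_subset_of_ncard_le (hf (Nat.le_succ t)) h.ge
        simp only [hs t this])
    exact (this _ (hm.trans (Nat.le_succ m))).trans (this _ hm).symm
  exact (Set.eq_of_subset_of_ncard_le (hf (Nat.le_succ m)) key.le).symm

/-- The points that `t` rounds of adding successors lead to. -/
def reachIn {α : Type*} (r : α → α → Prop) (S : Set α) : ℕ → Set α
  | 0 => S
  | t + 1 => {x | x ∈ reachIn r S t ∨ ∃ y ∈ reachIn r S t, r y x}

/-- Stage `m` equals stage `m + 1`, so it is closed under `r`. -/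
theorem mem_reachIn_iff {α : Type*} [Finite α] {r : α → α → Prop} {S : Set α} {m : ℕ}
    (hm : Nat.card α ≤ m) (x : α) : x ∈ reachIn r S m ↔ ∃ y ∈ S, ReflTransGen r y x := by
  have hmono : Monotone (reachIn r S) := monotone_nat_of_le_succ fun t x hx => Or.inl hx
  have hfix : reachIn r S (m + 1) = reachIn r S m :=
    mem_of_step_subset_of_card_le hmono (fun t h => by
      change {x | x ∈ reachIn r S t ∨ ∃ y ∈ reachIn r S t, r y x} =
        {x | x ∈ reachIn r S (t + 1) ∨ ∃ y ∈ reachIn r S (t + 1), r y x}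
      rw [← h]) hm
  constructor
  · have : ∀ t, ∀ x ∈ reachIn r S t, ∃ y ∈ S, ReflTransGen r y x := by
      intro t
      induction t with
      | zero => exact fun x hx => ⟨x, hx, .refl⟩
      | succ t ih =>
        rintro x (hx | ⟨y, hy, h⟩)
        · exact ih x hx
        · obtain ⟨z, hz, hzy⟩ := ih y hy
          exact ⟨z, hz, hzy.tail h⟩
    exact this m x
  · rintro ⟨y, hy, h⟩
    induction h with
    | refl => exact hmono (Nat.zero_le m) hy
    | tail _ h ih => rw [← hfix]; exact Or.inr ⟨_, ih, h⟩

/-- The points left after `t` rounds of removing those that violate a condition. -/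
def pruneIn {α : Type*} (c : Set α → α → Prop) : ℕ → Set α
  | 0 => Set.univ
  | t + 1 => {x | x ∈ pruneIn c t ∧ c (pruneIn c t) x}

/-- Together with `pruneIn_condition`, this makes the final stage the largest set whose points all
satisfy the condition relative to the set itself. -/
theorem subset_pruneIn {α : Type*} {c : Set α → α → Prop}
    (hc : ∀ S T : Set α, S ⊆ T → ∀ x, c S x → c T x) {S : Set α} (hS : ∀ x ∈ S, c S x) (t : ℕ) :
    S ⊆ pruneIn c t := by
  induction t with
  | zero => exact Set.subset_univ S
  | succ t ih => exact fun x hx => ⟨ih hx, hc _ _ ih x (hS x hx)⟩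

/-- The complements of the stages increase, so they are stable from index `m` on; a point of the
stable stage has survived one more round, which is the condition relative to that stage. -/
theorem pruneIn_condition {α : Type*} [Finite α] {c : Set α → α → Prop} {m : ℕ}
    (hm : Nat.card α ≤ m) : ∀ x ∈ pruneIn c m, c (pruneIn c m) x := by
  have hfix := mem_of_step_subset_of_card_le (f := fun t => (pruneIn c t)ᶜ)
    (monotone_nat_of_le_succ fun t x hx h => hx h.1) (fun t h => by
      have := compl_injective h
      change {x | x ∈ pruneIn c t ∧ c (pruneIn c t) x}ᶜ =
        {x | x ∈ pruneIn c (t + 1) ∧ c (pruneIn c (t + 1)) x}ᶜ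
      rw [← this]) hm
  intro x hx
  rw [← compl_injective hfix] at hx
  exact hx.2

/-! ### Common patterns as reachability in a product graph -/

namespace NFA

variable {A Q Q₁ Q₂ : Type*}

theorem nonempty_path_nil_iff {M : NFA A Q} {p q : Q} : Nonempty (M.Path p q []) ↔ p = q := by
  rw [← mem_evalFrom_iff_nonempty_path]
  simp [eq_comm]

theorem nonempty_path_cons_iff {M : NFA A Q} {p q : Q} {a : A} {w : List A} :
    Nonempty (M.Path p q (a :: w)) ↔ ∃ r ∈ M.step p a, Nonempty (M.Path r q w) := by
  constructor
  · rintro ⟨h⟩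
    cases h with
    | cons r _ _ _ _ h h' => exact ⟨r, h, ⟨h'⟩⟩
  · rintro ⟨r, h, ⟨h'⟩⟩
    exact ⟨.cons r _ _ _ _ h h'⟩

theorem nonempty_path_append_iff {M : NFA A Q} {q : Q} {u v : List A} : ∀ {p : Q},
    Nonempty (M.Path p q (u ++ v)) ↔
      ∃ r, Nonempty (M.Path p r u) ∧ Nonempty (M.Path r q v) := by
  induction u with
  | nil => simp [nonempty_path_nil_iff]
  | cons a u ih =>
    intro p
    simp only [List.cons_append, nonempty_path_cons_iff, ih]
    constructor
    · rintro ⟨r, h, s, h₁, h₂⟩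
      exact ⟨s, ⟨r, h, h₁⟩, h₂⟩
    · rintro ⟨s, ⟨r, h, h₁⟩, h₂⟩
      exact ⟨r, h, s, h₁, h₂⟩

/-- There is a transition labeled by a letter of `B`. -/
def Edge (M : NFA A Q) (B : Set A) (p q : Q) : Prop := ∃ a ∈ B, q ∈ M.step p a

theorem Edge.mono {M : NFA A Q} {B C : Set A} (h : B ⊆ C) {p q : Q} (he : M.Edge B p q) :
    M.Edge C p q :=
  he.imp fun _ h' => ⟨h h'.1, h'.2⟩

theorem reflTransGen_edge_mono {M : NFA A Q} {B C : Set A} (h : B ⊆ C) {p q : Q}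
    (hr : ReflTransGen (M.Edge B) p q) : ReflTransGen (M.Edge C) p q := by
  induction hr with
  | refl => exact .refl
  | tail _ h' ih => exact ih.tail (h'.mono h)

theorem subsetPath_iff {M : NFA A Q} {B : Set A} {p q : Q} :
    M.SubsetPath B p q ↔ ReflTransGen (M.Edge B) p q := by
  constructor
  · rintro ⟨w, hw, h⟩
    induction w generalizing p with
    | nil =>
      obtain rfl := nonempty_path_nil_iff.1 h
      exact .refl
    | cons a w ih =>
      obtain ⟨r, h₁, h₂⟩ := nonempty_path_cons_iff.1 h
      exact .head ⟨a, hw (by simp), h₁⟩ (ih (fun b hb => hw (by simp_all)) h₂)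
  · intro h
    induction h using ReflTransGen.head_induction_on with
    | refl => exact ⟨[], by simp, ⟨.nil _⟩⟩
    | head h _ ih =>
      obtain ⟨a, ha, h⟩ := h
      obtain ⟨w, hw, h'⟩ := ih
      refine ⟨a :: w, fun b hb => ?_, nonempty_path_cons_iff.2 ⟨_, h, h'⟩⟩
      rcases List.mem_cons.1 hb with rfl | hb
      · exact ha
      · exact hw hb

/-- There is a loop at `q` with labels in `B` and a transition labeled by `a`. -/
def LoopVia (M : NFA A Q) (q : Q) (B : Set A) (a : A) : Prop :=
  ∃ x y, ReflTransGen (M.Edge B) q x ∧ y ∈ M.step x a ∧ ReflTransGen (M.Edge B) y q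

theorem LoopVia.mono {M : NFA A Q} {q : Q} {B C : Set A} (h : B ⊆ C) {a : A}
    (hl : M.LoopVia q B a) : M.LoopVia q C a := by
  obtain ⟨x, y, h₁, h₂, h₃⟩ := hl
  exact ⟨x, y, reflTransGen_edge_mono h h₁, h₂, reflTransGen_edge_mono h h₃⟩

/-- Cutting a loop at an occurrence of `a` gives the local condition. Conversely, concatenating one
loop for each letter of the finite set `B` gives a loop in which all of them occur. -/
theorem eqPath_self_iff [Finite A] {M : NFA A Q} {B : Set A} {q : Q} :
    M.EqPath B q q ↔ ∀ a ∈ B, M.LoopVia q B a := by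
  constructor
  · rintro ⟨w, rfl, h⟩ a ha
    obtain ⟨u, v, rfl⟩ := List.append_of_mem ha
    obtain ⟨x, h₁, h₂⟩ := nonempty_path_append_iff.1 h
    obtain ⟨y, h₃, h₄⟩ := nonempty_path_cons_iff.1 h₂
    exact ⟨x, y, subsetPath_iff.1 ⟨u, fun b hb => by simp_all, h₁⟩, h₃,
      subsetPath_iff.1 ⟨v, fun b hb => by simp_all, h₄⟩⟩
  · intro h
    have key : ∀ F : Set A, F.Finite → F ⊆ B →
        ∃ w : List A, {a | a ∈ w} ⊆ B ∧ F ⊆ {a | a ∈ w} ∧ Nonempty (M.Path q q w) := by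
      intro F hF
      induction F, hF using Set.Finite.induction_on with
      | empty => exact fun _ => ⟨[], by simp, by simp, ⟨.nil q⟩⟩
      | @insert a F _ _ ih =>
        intro hB
        rw [Set.insert_subset_iff] at hB
        obtain ⟨w, hw, hFw, hp⟩ := ih hB.2
        obtain ⟨x, y, h₁, h₂, h₃⟩ := h a hB.1
        obtain ⟨u, hu, hu'⟩ := subsetPath_iff.2 h₁
        obtain ⟨v, hv, hv'⟩ := subsetPath_iff.2 h₃
        refine ⟨u ++ a :: (v ++ w), fun b hb => ?_, fun b hb => ?_, ?_⟩
        · simp only [List.mem_append, List.mem_cons, Set.mem_ofPred_eq] at hb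
          rcases hb with hb | rfl | hb | hb
          exacts [hu hb, hB.1, hv hb, hw hb]
        · rcases hb with rfl | hb
          · simp
          · have := hFw hb
            simp_all
        · exact nonempty_path_append_iff.2 ⟨x, hu', nonempty_path_cons_iff.2 ⟨y, h₂,
            nonempty_path_append_iff.2 ⟨q, hv', hp⟩⟩⟩
    obtain ⟨w, h₁, h₂, h₃⟩ := key B B.toFinite subset_rfl
    exact ⟨w, h₁.antisymm h₂, h₃⟩

/-- The condition that a letter has to satisfy to occur in loops of both automata. -/
def CommonLoopVia (M₁ : NFA A Q₁) (M₂ : NFA A Q₂) (q : Q₁ × Q₂) (B : Set A) (a : A) : Prop :=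
  M₁.LoopVia q.1 B a ∧ M₂.LoopVia q.2 B a

/-- One step in the product of two automata: read a letter, or pass a loop of both automata with
the same set of letters. -/
def CommonStep (M₁ : NFA A Q₁) (M₂ : NFA A Q₂) (G : Q₁ × Q₂ → Set A) (x y : Q₁ × Q₂) : Prop :=
  (∃ a, y.1 ∈ M₁.step x.1 a ∧ y.2 ∈ M₂.step x.2 a) ∨
  ∃ q, (G q).Nonempty ∧
    ReflTransGen (M₁.Edge (G q)) x.1 q.1 ∧ ReflTransGen (M₂.Edge (G q)) x.2 q.2 ∧
    ReflTransGen (M₁.Edge (G q)) q.1 y.1 ∧ ReflTransGen (M₂.Edge (G q)) q.2 y.2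

/-- `AdmitsPath` for the paths from a given state. -/
def AdmitsFrom (M : NFA A Q) (x : Q) (P : FactorizationPattern A) : Prop :=
  ∃ s t : Fin (P.p + 1) → Q,
    s 0 = x ∧ t (Fin.last P.p) ∈ M.accept ∧
    (∀ i, Nonempty (M.Path (s i) (t i) (P.u i))) ∧
    ∀ i : Fin P.p, ∃ q : Q,
      M.SubsetPath (P.B i) (t i.castSucc) q ∧
      M.EqPath (P.B i) q q ∧
      M.SubsetPath (P.B i) q (s i.succ)

theorem admitsPath_iff {M : NFA A Q} {P : FactorizationPattern A} :
    M.AdmitsPath P ↔ ∃ x ∈ M.start, M.AdmitsFrom x P := by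
  constructor
  · rintro ⟨s, t, h₁, h₂⟩
    exact ⟨s 0, h₁, s, t, rfl, h₂⟩
  · rintro ⟨x, hx, s, t, rfl, h₂⟩
    exact ⟨s, t, hx, h₂⟩

/-- The pattern of the empty word. -/
def _root_.FactorizationPattern.nil : FactorizationPattern A where
  p := 0
  u _ := []
  B i := i.elim0
  B_nonempty i := i.elim0

/-- Read a letter before a pattern. -/
def _root_.FactorizationPattern.consLetter (a : A) (P : FactorizationPattern A) :
    FactorizationPattern A where
  p := P.p
  u := Fin.cons (a :: P.u 0) fun i => P.u i.succ
  B := P.B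
  B_nonempty := P.B_nonempty

/-- Pass a loop before a pattern. -/
def _root_.FactorizationPattern.consLoop (B : Set A) (hB : B.Nonempty)
    (P : FactorizationPattern A) : FactorizationPattern A where
  p := P.p + 1
  u := Fin.cons [] P.u
  B := Fin.cons B P.B
  B_nonempty i := by
    induction i using Fin.cases with
    | zero => exact hB
    | succ i => exact P.B_nonempty i

theorem admitsFrom_nil {M : NFA A Q} {x : Q} (hx : x ∈ M.accept) : M.AdmitsFrom x .nil :=
  ⟨fun _ => x, fun _ => x, rfl, hx, fun _ => ⟨.nil x⟩, fun i => i.elim0⟩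

theorem AdmitsFrom.consLetter {M : NFA A Q} {x y : Q} {P : FactorizationPattern A} {a : A}
    (h : y ∈ M.step x a) (hP : M.AdmitsFrom y P) : M.AdmitsFrom x (P.consLetter a) := by
  obtain ⟨s, t, rfl, h₂, h₃, h₄⟩ := hP
  refine ⟨Fin.cons x fun i => s i.succ, t, rfl, h₂, fun i => ?_, fun i => h₄ i⟩
  induction i using Fin.cases with
  | zero => exact nonempty_path_cons_iff.2 ⟨_, h, h₃ 0⟩
  | succ i => exact h₃ i.succ

theorem AdmitsFrom.consLoop {M : NFA A Q} {x y q : Q} {P : FactorizationPattern A} {B : Set A}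
    {hB : B.Nonempty} (h₁ : M.SubsetPath B x q) (h₂ : M.EqPath B q q) (h₃ : M.SubsetPath B q y)
    (hP : M.AdmitsFrom y P) : M.AdmitsFrom x (P.consLoop B hB) := by
  obtain ⟨s, t, rfl, h₄, h₅, h₆⟩ := hP
  -- The new block is preceded by the empty word, so the new first segment starts and ends at `x`.
  refine ⟨Fin.cons x s, Fin.cons x t, rfl, h₄, fun i => ?_, fun i => ?_⟩
  · induction i using Fin.cases with
    | zero => exact ⟨.nil x⟩
    | succ i => exact h₅ i
  · induction i using Fin.cases with
    | zero => exact ⟨q, h₁, h₂, h₃⟩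
    | succ i => exact h₆ i

/-- A pattern may use different subalphabets at the same pair `q`, but all of them lie in the pruned
set of `q`, which can replace each of them in both automata at once. Conversely, the steps of a path
in the product graph are prefixed one by one to a pattern, starting from the empty one. -/
theorem exists_common_pattern_iff [Finite A] {M₁ : NFA A Q₁} {M₂ : NFA A Q₂} {m : ℕ}
    (hm : Nat.card A ≤ m) :
    (∃ P : FactorizationPattern A, M₁.AdmitsPath P ∧ M₂.AdmitsPath P) ↔
      ∃ x y : Q₁ × Q₂, (x.1 ∈ M₁.start ∧ x.2 ∈ M₂.start) ∧ (y.1 ∈ M₁.accept ∧ y.2 ∈ M₂.accept) ∧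
        ReflTransGen (CommonStep M₁ M₂ fun q => pruneIn (CommonLoopVia M₁ M₂ q) m) x y := by
  set r := CommonStep M₁ M₂ fun q => pruneIn (CommonLoopVia M₁ M₂ q) m with hr
  constructor
  · rintro ⟨P, ⟨s₁, t₁, hs₁, ht₁, hu₁, hB₁⟩, ⟨s₂, t₂, hs₂, ht₂, hu₂, hB₂⟩⟩
    have hword : ∀ (u : List A) p₁ q₁ p₂ q₂, Nonempty (M₁.Path p₁ q₁ u) →
        Nonempty (M₂.Path p₂ q₂ u) → ReflTransGen r (p₁, p₂) (q₁, q₂) := by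
      intro u
      induction u with
      | nil =>
        intro p₁ q₁ p₂ q₂ h₁ h₂
        obtain rfl := nonempty_path_nil_iff.1 h₁
        obtain rfl := nonempty_path_nil_iff.1 h₂
        exact .refl
      | cons a u ih =>
        intro p₁ q₁ p₂ q₂ h₁ h₂
        obtain ⟨r₁, h₁, h₁'⟩ := nonempty_path_cons_iff.1 h₁
        obtain ⟨r₂, h₂, h₂'⟩ := nonempty_path_cons_iff.1 h₂
        exact .head (.inl ⟨a, h₁, h₂⟩) (ih _ _ _ _ h₁' h₂')
    refine ⟨(s₁ 0, s₂ 0), (t₁ (Fin.last _), t₂ (Fin.last _)), ⟨hs₁, hs₂⟩, ⟨ht₁, ht₂⟩, ?_⟩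
    have : ∀ i : Fin (P.p + 1), ReflTransGen r (s₁ 0, s₂ 0) (t₁ i, t₂ i) := by
      intro i
      induction i using Fin.induction with
      | zero => exact hword _ _ _ _ _ (hu₁ 0) (hu₂ 0)
      | succ i ih =>
        refine (ih.tail (.inr ?_)).trans (hword _ _ _ _ _ (hu₁ i.succ) (hu₂ i.succ))
        obtain ⟨q₁, h₁, h₂, h₃⟩ := hB₁ i
        obtain ⟨q₂, h₄, h₅, h₆⟩ := hB₂ i
        -- `P.B i` satisfies the loop condition relative to itself, so it survives every round of
        -- pruning.
        have hsub : P.B i ⊆ pruneIn (CommonLoopVia M₁ M₂ (q₁, q₂)) m := by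
          refine subset_pruneIn (fun S T h x hx => ⟨hx.1.mono h, hx.2.mono h⟩) (fun a ha => ?_) m
          exact ⟨eqPath_self_iff.1 h₂ a ha, eqPath_self_iff.1 h₅ a ha⟩
        exact ⟨(q₁, q₂), (P.B_nonempty i).mono hsub,
          reflTransGen_edge_mono hsub (subsetPath_iff.1 h₁),
          reflTransGen_edge_mono hsub (subsetPath_iff.1 h₄),
          reflTransGen_edge_mono hsub (subsetPath_iff.1 h₃),
          reflTransGen_edge_mono hsub (subsetPath_iff.1 h₆)⟩
    exact this _
  · rintro ⟨x, y, ⟨hx₁, hx₂⟩, ⟨hy₁, hy₂⟩, h⟩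
    suffices ∃ P, M₁.AdmitsFrom x.1 P ∧ M₂.AdmitsFrom x.2 P by
      obtain ⟨P, h₁, h₂⟩ := this
      exact ⟨P, admitsPath_iff.2 ⟨_, hx₁, h₁⟩, admitsPath_iff.2 ⟨_, hx₂, h₂⟩⟩
    clear hx₁ hx₂
    induction h using ReflTransGen.head_induction_on with
    | refl => exact ⟨.nil, admitsFrom_nil hy₁, admitsFrom_nil hy₂⟩
    | head h _ ih =>
      obtain ⟨P, h₁, h₂⟩ := ih
      rcases h with ⟨a, ha₁, ha₂⟩ | ⟨q, hG, hq₁, hq₂, hq₃, hq₄⟩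
      · exact ⟨P.consLetter a, h₁.consLetter ha₁, h₂.consLetter ha₂⟩
      -- The pruned set is itself a legitimate subalphabet for a loop at `q`; this is where enough
      -- rounds of pruning are needed.
      · have hc := pruneIn_condition (c := CommonLoopVia M₁ M₂ q) hm
        exact ⟨P.consLoop _ hG,
          h₁.consLoop (subsetPath_iff.2 hq₁) (eqPath_self_iff.2 fun a ha => (hc a ha).1)
            (subsetPath_iff.2 hq₃),
          h₂.consLoop (subsetPath_iff.2 hq₂) (eqPath_self_iff.2 fun a ha => (hc a ha).2)
            (subsetPath_iff.2 hq₄)⟩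

end NFA

end

/-! ### A loop language and its compilation to stack machines -/

namespace LoopProg

open Turing Function

/-- Names of the bit arrays. -/
abbrev Arr := Fin 20

/-- Names of the loop counters. -/
abbrev Ctr := Fin 16

/-- A loop language with a stack of bits, bit arrays with a head position, and counters that
range over the numbers below a global parameter. -/
inductive Prog
  | skip
  | const (b : Bool)
  | op (f : Bool → Bool → Bool)
  | get (a : Arr)
  | put (a : Arr)
  | right (a : Arr)
  | left (a : Arr)
  | seq (P Q : Prog)
  | ite (P Q : Prog)
  | rep (c : Ctr) (P : Prog)
  | times (c : Ctr) (P : Prog)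

/-- The store of a loop program. -/
@[ext] structure Store where
  bst : List Bool
  arr : Arr → ℕ → Bool
  pos : Arr → ℕ

namespace Prog

/-- The meaning of a loop program, for the loop bound `N` and the counter values `env`. -/
def eval (N : ℕ) : Prog → (Ctr → ℕ) → Store → Store
  | skip, _, s => s
  | const b, _, s => { s with bst := b :: s.bst }
  | op f, _, s =>
    { s with bst := f (s.bst.headD false) (s.bst.tail.headD false) :: s.bst.tail.tail }
  | get a, _, s => { s with bst := s.arr a (s.pos a) :: s.bst }
  | put a, _, s =>
    { s with
      bst := s.bst.tail
      arr := update s.arr a (update (s.arr a) (s.pos a) (s.bst.headD false)) }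
  | right a, _, s => { s with pos := update s.pos a (s.pos a + 1) }
  | left a, _, s => { s with pos := update s.pos a (s.pos a - 1) }
  | seq P Q, env, s => eval N Q env (eval N P env s)
  | ite P Q, env, s =>
    if s.bst.headD false then eval N P env { s with bst := s.bst.tail }
    else eval N Q env { s with bst := s.bst.tail }
  | rep c P, env, s => (List.range N).foldl (fun s i => eval N P (update env c i) s) s
  | times c P, env, s => (eval N P env)^[env c] s

/-- The counters that occur in a program. -/
def used : Prog → List Ctr
  | seq P Q => used P ++ used Q
  | ite P Q => used P ++ used Q
  | rep c P => c :: used P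
  | times c P => c :: used P
  | _ => []

/-- The counters that a program loops over. -/
def looped : Prog → List Ctr
  | seq P Q => looped P ++ looped Q
  | ite P Q => looped P ++ looped Q
  | rep c P => c :: looped P
  | times _ P => looped P
  | _ => []

/-- Loops over the same counter are not nested, and the body of no `times` loop uses its counter. -/
def WF : Prog → Prop
  | seq P Q => WF P ∧ WF Q
  | ite P Q => WF P ∧ WF Q
  | rep c P => c ∉ looped P ∧ WF P
  | times c P => c ∉ used P ∧ WF P
  | _ => True

/-- A bound for the number of machine steps, as a polynomial in the loop bound. -/
noncomputable def cost : Prog → Polynomial ℕ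
  | seq P Q => cost P + cost Q
  | ite P Q => 1 + cost P + cost Q
  | rep _ P => Polynomial.X * (cost P + 3) + 2
  | times _ P => Polynomial.X * (cost P + 3) + 2
  | _ => 1

end Prog

/-- The stacks of the machine. -/
inductive Stk
  | io
  | bst
  | lft (a : Arr)
  | rgt (a : Arr)
  | todo (c : Ctr)
  | done (c : Ctr)
  | aux (c : Ctr)
  deriving DecidableEq, Fintype

/-- The local variables of the machine: two buffers. -/
abbrev Buf := Option Bool × Option Bool

/-- Statements of the machine. -/
abbrev MStmt (Λ : Type) := TM2.Stmt (fun _ : Stk => Bool) Λ Buf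

/-- Configurations of the machine. -/
abbrev MCfg (Λ : Type) := TM2.Cfg (fun _ : Stk => Bool) Λ Buf

/-- `n` steps of the machine `M` lead from `a` to `b`. -/
def Runs {Λ : Type} (M : Λ → MStmt Λ) (n : ℕ) (a b : MCfg Λ) : Prop :=
  (flip bind (TM2.step M))^[n] (some a) = some b

theorem Runs.trans {Λ : Type} {M : Λ → MStmt Λ} {m n : ℕ} {a b c : MCfg Λ}
    (h₁ : Runs M m a b) (h₂ : Runs M n b c) : Runs M (m + n) a c := by
  unfold Runs at *
  rw [add_comm, iterate_add_apply, h₁, h₂]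

theorem Runs.step {Λ : Type} {M : Λ → MStmt Λ} {l : Λ} {v : Buf} {S : Stk → List Bool}
    {b : MCfg Λ} (h : TM2.stepAux (M l) v S = b) : Runs M 1 ⟨some l, v, S⟩ b := by
  subst h; rfl

/-- A program fragment: machine code with one entry and one exit. -/
structure Frag where
  Lab : Type
  [fin : Fintype Lab]
  entry : Lab
  code : {Λ : Type} → (Lab → Λ) → Λ → Lab → MStmt Λ

attribute [instance] Frag.fin

namespace Frag

/-- Inside every machine that contains the fragment, `n` steps lead from its entry to its exit. -/
def Exec (F : Frag) (n : ℕ) (v : Buf) (S : Stk → List Bool) (v' : Buf) (S' : Stk → List Bool) :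
    Prop :=
  ∀ {Λ : Type} (M : Λ → MStmt Λ) (emb : F.Lab → Λ) (exit : Λ),
    (∀ l, M (emb l) = F.code emb exit l) →
    Runs M n ⟨some (emb F.entry), v, S⟩ ⟨some exit, v', S'⟩

/-- A fragment with a single label. -/
abbrev atom (f : {Λ : Type} → MStmt Λ → MStmt Λ) : Frag where
  Lab := Unit
  entry := ()
  code _ exit _ := f (.goto fun _ => exit)

theorem exec_atom {f : {Λ : Type} → MStmt Λ → MStmt Λ} {v v' : Buf} {S S' : Stk → List Bool}
    (h : ∀ {Λ : Type} (x : Λ), TM2.stepAux (f (.goto fun _ => x)) v S = ⟨some x, v', S'⟩) :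
    (atom f).Exec 1 v S v' S' := by
  intro Λ M emb exit hM
  apply Runs.step
  rw [hM]
  exact h exit

/-- Run one fragment after the other. -/
abbrev seq (F G : Frag) : Frag where
  Lab := F.Lab ⊕ G.Lab
  entry := .inl F.entry
  code emb exit l :=
    match l with
    | .inl l => F.code (emb ∘ .inl) (emb (.inr G.entry)) l
    | .inr l => G.code (emb ∘ .inr) exit l

theorem exec_seq {F G : Frag} {m n : ℕ} {v₁ v₂ v₃ : Buf} {S₁ S₂ S₃ : Stk → List Bool}
    (h₁ : F.Exec m v₁ S₁ v₂ S₂) (h₂ : G.Exec n v₂ S₂ v₃ S₃) :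
    (F.seq G).Exec (m + n) v₁ S₁ v₃ S₃ := by
  intro Λ M emb exit hM
  exact (h₁ M (emb ∘ .inl) (emb (.inr G.entry)) fun l => hM (.inl l)).trans
    (h₂ M (emb ∘ .inr) exit fun l => hM (.inr l))

/-- Pop a bit and choose a fragment accordingly. -/
abbrev ite (F G : Frag) : Frag where
  Lab := Option (F.Lab ⊕ G.Lab)
  entry := none
  code emb exit l :=
    match l with
    | none => .pop .bst (fun v o => (o, v.2)) <| .goto fun v =>
        if v.1.getD false then emb (some (.inl F.entry)) else emb (some (.inr G.entry))
    | some (.inl l) => F.code (fun l => emb (some (.inl l))) exit l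
    | some (.inr l) => G.code (fun l => emb (some (.inr l))) exit l

/-- Move the bits of the stack `k₁` to `k₂` one by one, running a fragment for each. -/
abbrev loop (F : Frag) (peekPop : Bool) (k₁ k₂ : Stk) : Frag where
  Lab := Fin 3 ⊕ F.Lab
  entry := .inl 0
  code emb exit l :=
    match l with
    | .inl 0 =>
      -- With `peekPop` the bit moves after the body, so in round `i` the stack `k₂` has received
      -- `i` bits: its height is the counter value. Otherwise the bit moves before the body, and the
      -- remaining height of `k₁` is the number of rounds still to come.
      if peekPop then
        .peek k₁ (fun v o => (o, v.2)) <| .goto fun v =>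
          if v.1.isSome then emb (.inr F.entry) else emb (.inl 2)
      else
        .pop k₁ (fun v o => (o, v.2)) <|
          .branch (fun v => v.1.isSome)
            (.push k₂ (fun _ => true) <| .goto fun _ => emb (.inr F.entry))
            (.goto fun _ => emb (.inl 2))
    | .inl 1 =>
      if peekPop then
        .pop k₁ (fun v _ => v) <| .push k₂ (fun _ => true) <| .goto fun _ => emb (.inl 0)
      else .goto fun _ => emb (.inl 0)
    | .inl 2 =>
      .pop k₂ (fun v o => (o, v.2)) <|
        .branch (fun v => v.1.isSome)
          (.push k₁ (fun _ => true) <| .goto fun _ => emb (.inl 2))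
          (.goto fun _ => exit)
    | .inr l => F.code (fun l => emb (.inr l)) (emb (.inl 1)) l

end Frag

/-- The machine code of an elementary program. -/
def stmtOf {Λ : Type} : Prog → MStmt Λ → MStmt Λ
  | .const b, q => .push .bst (fun _ => b) q
  | .op f, q => .pop .bst (fun v o => (o, v.2)) <| .pop .bst (fun v o => (v.1, o)) <|
      .push .bst (fun v => f (v.1.getD false) (v.2.getD false)) q
  | .get a, q => .peek (.rgt a) (fun v o => (o, v.2)) <| .push .bst (fun v => v.1.getD false) q
  | .put a, q => .pop .bst (fun v o => (o, v.2)) <| .pop (.rgt a) (fun v _ => v) <|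
      .push (.rgt a) (fun v => v.1.getD false) q
  | .right a, q => .pop (.rgt a) (fun v o => (o, v.2)) <|
      .push (.lft a) (fun v => v.1.getD false) q
  | .left a, q => .pop (.lft a) (fun v o => (o, v.2)) <|
      .branch (fun v => v.1.isSome) (.push (.rgt a) (fun v => v.1.getD false) q) q
  | _, q => q

/-- The machine code of a loop program. -/
def compile : Prog → Frag
  | .seq P Q => (compile P).seq (compile Q)
  | .ite P Q => (compile P).ite (compile Q)
  | .rep c P => (compile P).loop true (.todo c) (.done c)
  | .times c P => (compile P).loop false (.done c) (.aux c)
  | P => .atom (stmtOf P)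

/-- The stacks `S` represent the store `s`, the counter values `env`, and the numbers `aux` of
rounds made by the enclosing `times` loops. -/
structure Rel (N : ℕ) (env aux : Ctr → ℕ) (s : Store) (S : Stk → List Bool) : Prop where
  io : S .io = []
  bst : S .bst = s.bst
  todo : ∀ c, S (.todo c) = List.replicate (N - env c) true
  done : ∀ c, S (.done c) = List.replicate (env c - aux c) true
  aux : ∀ c, S (.aux c) = List.replicate (aux c) true
  pos : ∀ a, (S (.lft a)).length = s.pos a
  arr : ∀ a n, ((S (.lft a)).reverse ++ S (.rgt a)).getD n false = s.arr a n

end LoopProg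

/-! ### Simulation of the loop constructs -/

namespace LoopProg

open Turing Function

/-- Cells beyond the stored part of a tape read as `false`. A head that moves past the end writes
such a cell explicitly, which leaves the contents unchanged. -/
theorem getD_reverse_cons_tail (l r : List Bool) (n : ℕ) :
    ((r.head?.getD false :: l).reverse ++ r.tail).getD n false = (l.reverse ++ r).getD n false := by
  cases r with
  | nil =>
    simp only [List.reverse_cons, List.tail_nil, List.append_nil, List.head?_nil, Option.getD_none,
      List.getD_eq_getElem?_getD, List.getElem?_append]
    split
    · rfl
    · rename_i h
      rw [List.getElem?_eq_none (not_lt.1 h)]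
      rcases n - l.reverse.length with _ | m <;> simp
  | cons x r => simp

theorem getD_append_cons_tail (l r : List Bool) (b : Bool) (n : ℕ) :
    (l ++ b :: r.tail).getD n false = if n = l.length then b else (l ++ r).getD n false := by
  simp only [List.getD_eq_getElem?_getD, List.getElem?_append]
  split_ifs with h₁ h₂ h₂
  · omega
  · rfl
  · simp [h₂]
  · obtain ⟨m, hm⟩ : ∃ m, n - l.length = m + 1 := ⟨n - l.length - 1, by omega⟩
    rw [hm]
    cases r <;> simp

/-- From every store, a fragment runs in at most `t` steps as the program `P` does. -/
def Simulates (N : ℕ) (F : Frag) (env aux : Ctr → ℕ) (f : Store → Store) (t : ℕ) : Prop :=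
  ∀ s S v, Rel N env aux s S → ∃ n v' S', n ≤ t ∧ F.Exec n v S v' S' ∧ Rel N env aux (f s) S' ∧
    ∀ k, (S' k).length ≤ (S k).length + n

theorem simulates_atom {N : ℕ} (P : Prog) {env aux : Ctr → ℕ}
    (v' : Buf → (Stk → List Bool) → Buf)
    (S' : Buf → (Stk → List Bool) → Stk → List Bool)
    (hf : ∀ {Λ : Type} (x : Λ) v S,
      TM2.stepAux (stmtOf P (.goto fun _ => x)) v S = ⟨some x, v' v S, S' v S⟩)
    (hS : ∀ v s S, Rel N env aux s S → Rel N env aux (P.eval N env s) (S' v S))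
    (hl : ∀ v S k, (S' v S k).length ≤ (S k).length + 1) :
    Simulates N (.atom (stmtOf P)) env aux (P.eval N env) 1 := fun s S v h =>
  ⟨1, v' v S, S' v S, le_rfl, Frag.exec_atom fun x => hf x v S, hS v s S h, hl v S⟩

/-- The additional step is the one that finds `k₂` empty and exits. -/
theorem runs_restore {F : Frag} {p : Bool} {k₁ k₂ : Stk} (hk : k₁ ≠ k₂) {Λ : Type}
    {M : Λ → MStmt Λ} {emb : (F.loop p k₁ k₂).Lab → Λ} {exit : Λ}
    (hM : ∀ l, M (emb l) = (F.loop p k₁ k₂).code emb exit l) (m : ℕ) :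
    ∀ v S, S k₂ = List.replicate m true →
      Runs M (m + 1) ⟨some (emb (.inl 2)), v, S⟩
        ⟨some exit, (none, v.2), update (update S k₁ (List.replicate m true ++ S k₁)) k₂ []⟩ := by
  induction m with
  | zero =>
    intro v S hS
    apply Runs.step
    rw [hM]
    simp only [TM2.stepAux, hS]
    simp
  | succ m ih =>
    intro v S hS
    rw [show m + 1 + 1 = 1 + (m + 1) by ring]
    refine Runs.trans (b := ⟨some (emb (.inl 2)), (some true, v.2),
      update (update S k₂ (List.replicate m true)) k₁ (true :: S k₁)⟩) (Runs.step ?_) ?_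
    · rw [hM]
      simp only [TM2.stepAux, hS]
      simp [List.replicate_succ, hk]
    · have e : update (update S k₁ (List.replicate (m + 1) true ++ S k₁)) k₂ [] =
          update (update (update (update S k₂ (List.replicate m true)) k₁ (true :: S k₁)) k₁
            (List.replicate m true ++ true :: S k₁)) k₂ [] := by
        funext k
        by_cases h₂ : k = k₂
        · subst h₂; simp
        · by_cases h₁ : k = k₁
          · subst h₁; simp [h₂, List.replicate_succ']
          · simp [h₁, h₂]
      rw [e]
      simpa using ih (some true, v.2)
        (update (update S k₂ (List.replicate m true)) k₁ (true :: S k₁)) (by simp [hk.symm])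

/-- A round costs one step for the test, at most `t` for the body and one for moving a bit, so `N`
rounds cost `N * (t + 2)`. One more step finds `todo c` empty, and `N + 1` steps move the bits back.
-/
theorem simulates_rep {N : ℕ} {F : Frag} {env aux : Ctr → ℕ} {c : Ctr} {f : ℕ → Store → Store}
    {t : ℕ} (henv : env c = 0) (haux : aux c = 0)
    (hF : ∀ i < N, Simulates N F (update env c i) aux (f i) t) :
    Simulates N (F.loop true (.todo c) (.done c)) env aux
      (fun s => (List.range N).foldl (fun s i => f i s) s) (N * (t + 3) + 2) := by
  have key : ∀ d i, i + d = N → ∀ s S v, Rel N (update env c i) aux s S →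
      ∃ n v' S', n ≤ d * (t + 2) + 1 ∧
        (∀ {Λ : Type} (M : Λ → MStmt Λ) (emb : (F.loop true (.todo c) (.done c)).Lab → Λ)
          (exit : Λ), (∀ l, M (emb l) = (F.loop true (.todo c) (.done c)).code emb exit l) →
          Runs M n ⟨some (emb (.inl 0)), v, S⟩ ⟨some (emb (.inl 2)), v', S'⟩) ∧
        Rel N (update env c N) aux ((List.range' i d).foldl (fun s i => f i s) s) S' ∧
        ∀ k, (S' k).length ≤ (S k).length + n := by
    intro d
    induction d with
    | zero =>
      intro i hi s S v h
      obtain rfl : i = N := by omega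
      refine ⟨1, (none, v.2), S, by omega, ?_, h, fun k => by omega⟩
      intro Λ M emb exit hM
      apply Runs.step
      rw [hM]
      have := h.todo c
      simp only [update_self, Nat.sub_self, List.replicate_zero] at this
      simp [TM2.stepAux, this]
    | succ d ih =>
      intro i hi s S v h
      obtain ⟨n₁, v₁, S₁, hn₁, hx₁, h₁, hl₁⟩ := hF i (by omega) s S (some true, v.2) h
      have hr : Rel N (update env c (i + 1)) aux (f i s)
          (update (update S₁ (.todo c) (S₁ (.todo c)).tail) (.done c) (true :: S₁ (.done c))) := by
        refine ⟨?_, ?_, fun c' => ?_, fun c' => ?_, fun c' => ?_, fun a => ?_, fun a n => ?_⟩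
        · simpa using h₁.io
        · simpa using h₁.bst
        · by_cases hc : c' = c
          · subst hc
            have := h₁.todo c'
            simp only [update_self] at this
            rw [show N - i = N - (i + 1) + 1 by omega] at this
            simp [this]
          · simpa [hc] using h₁.todo c'
        · by_cases hc : c' = c
          · subst hc
            have := h₁.done c'
            simp only [update_self, haux] at this
            simp [this, haux, List.replicate_succ]
          · simpa [hc] using h₁.done c'
        · simpa using h₁.aux c'
        · simpa using h₁.pos a
        · simpa using h₁.arr a n
      obtain ⟨n₂, v₂, S₂, hn₂, hx₂, h₂, hl₂⟩ := ih (i + 1) (by omega) (f i s) _ v₁ hr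
      refine ⟨1 + n₁ + 1 + n₂, v₂, S₂, by nlinarith, ?_, ?_, fun k => ?_⟩
      · intro Λ M emb exit hM
        refine ((Runs.trans (Runs.step ?_) (hx₁ M (fun l => emb (.inr l)) (emb (.inl 1))
          fun l => hM (.inr l))).trans (Runs.step ?_)).trans (hx₂ M emb exit hM)
        · rw [hM]
          have := h.todo c
          rw [update_self, show N - i = N - (i + 1) + 1 by omega] at this
          simp [TM2.stepAux, this, List.replicate_succ]
        · rw [hM]
          simp [TM2.stepAux]
      · exact h₂
      · have a₁ := hl₁ k
        have a₂ := hl₂ k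
        have : (update (update S₁ (.todo c) (S₁ (.todo c)).tail) (.done c)
            (true :: S₁ (.done c)) k).length ≤ (S₁ k).length + 1 := by
          by_cases e₁ : k = .done c
          · subst e₁; simp
          · by_cases e₂ : k = .todo c
            · subst e₂; simp; omega
            · simp [e₁, e₂]
        omega
  intro s S v h
  have h0 : Rel N (update env c 0) aux s S := by rwa [← henv, update_eq_self]
  obtain ⟨n, v', S', hn, hx, h', hl⟩ := key N 0 (by omega) s S v h0
  have hd : S' (.done c) = List.replicate N true := by simpa [haux] using h'.done c
  have ht : S' (.todo c) = [] := by simpa using h'.todo c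
  refine ⟨n + (N + 1), (none, v'.2), update (update S' (.todo c) (List.replicate N true ++
    S' (.todo c))) (.done c) [], by nlinarith, ?_, ?_, ?_⟩
  · intro Λ M emb exit hM
    exact (hx M emb exit hM).trans (runs_restore (by simp) hM N v' S' hd)
  · rw [List.range_eq_range']
    refine ⟨?_, ?_, fun c' => ?_, fun c' => ?_, fun c' => ?_, fun a => ?_, fun a n => ?_⟩
    · simpa using h'.io
    · simpa using h'.bst
    · by_cases hc : c' = c
      · subst hc
        simp [ht, henv]
      · simpa [hc] using h'.todo c'
    · by_cases hc : c' = c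
      · subst hc
        simp [henv]
      · simpa [hc] using h'.done c'
    · simpa using h'.aux c'
    · simpa using h'.pos a
    · simpa using h'.arr a n
  · intro k
    have a₁ := hl k
    by_cases e₁ : k = .done c
    · subst e₁; simp
    · by_cases e₂ : k = .todo c
      · subst e₂; simp [ht]; omega
      · simp [e₁, e₂]; omega

/-- The counter keeps its value while its bits are lent from `done c` to `aux c`; the number lent is
recorded in `aux c`. The body must therefore be simulated for every value of `aux c`. The bound uses
that the number `env c` of rounds is at most `N`. -/
theorem simulates_times {N : ℕ} {F : Frag} {env aux : Ctr → ℕ} {c : Ctr} {f : Store → Store}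
    {t : ℕ} (henv : env c ≤ N) (haux : aux c = 0)
    (hF : ∀ i, Simulates N F env (update aux c i) f t) :
    Simulates N (F.loop false (.done c) (.aux c)) env aux (f^[env c]) (N * (t + 3) + 2) := by
  have key : ∀ d i, i + d = env c → ∀ s S v, Rel N env (update aux c i) s S →
      ∃ n v' S', n ≤ d * (t + 2) + 1 ∧
        (∀ {Λ : Type} (M : Λ → MStmt Λ) (emb : (F.loop false (.done c) (.aux c)).Lab → Λ)
          (exit : Λ), (∀ l, M (emb l) = (F.loop false (.done c) (.aux c)).code emb exit l) →
          Runs M n ⟨some (emb (.inl 0)), v, S⟩ ⟨some (emb (.inl 2)), v', S'⟩) ∧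
        Rel N env (update aux c (env c)) (f^[d] s) S' ∧
        ∀ k, (S' k).length ≤ (S k).length + n := by
    intro d
    induction d with
    | zero =>
      intro i hi s S v h
      obtain rfl : i = env c := by omega
      have hd := h.done c
      simp only [update_self, Nat.sub_self, List.replicate_zero] at hd
      refine ⟨1, (none, v.2), S, by omega, ?_, h, fun k => by omega⟩
      intro Λ M emb exit hM
      apply Runs.step
      rw [hM]
      have he : update S (.done c) [] = S := by rw [← hd, update_eq_self]
      simp [TM2.stepAux, hd, he]
    | succ d ih =>
      intro i hi s S v h
      have hd := h.done c
      rw [update_self, show env c - i = env c - (i + 1) + 1 by omega] at hd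
      have hr : Rel N env (update aux c (i + 1)) s
          (update (update S (.done c) (S (.done c)).tail) (.aux c) (true :: S (.aux c))) := by
        refine ⟨?_, ?_, fun c' => ?_, fun c' => ?_, fun c' => ?_, fun a => ?_, fun a n => ?_⟩
        · simpa using h.io
        · simpa using h.bst
        · simpa using h.todo c'
        · by_cases hc : c' = c
          · subst hc
            simp [hd]
          · simpa [hc] using h.done c'
        · by_cases hc : c' = c
          · subst hc
            have := h.aux c'
            simp only [update_self] at this
            simp [this, List.replicate_succ]
          · simpa [hc] using h.aux c'
        · simpa using h.pos a
        · simpa using h.arr a n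
      obtain ⟨n₁, v₁, S₁, hn₁, hx₁, h₁, hl₁⟩ := hF (i + 1) s _ (some true, v.2) hr
      obtain ⟨n₂, v₂, S₂, hn₂, hx₂, h₂, hl₂⟩ := ih (i + 1) (by omega) (f s) _ v₁ h₁
      refine ⟨1 + n₁ + 1 + n₂, v₂, S₂, by nlinarith, ?_, ?_, fun k => ?_⟩
      · intro Λ M emb exit hM
        refine ((Runs.trans (Runs.step ?_) (hx₁ M (fun l => emb (.inr l)) (emb (.inl 1))
          fun l => hM (.inr l))).trans (Runs.step ?_)).trans (hx₂ M emb exit hM)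
        · rw [hM]
          simp [TM2.stepAux, hd, List.replicate_succ]
        · rw [hM]
          simp [TM2.stepAux]
      · exact h₂
      · have a₁ := hl₁ k
        have a₂ := hl₂ k
        have : (update (update S (.done c) (S (.done c)).tail) (.aux c)
            (true :: S (.aux c)) k).length ≤ (S k).length + 1 := by
          by_cases e₁ : k = .aux c
          · subst e₁; simp
          · by_cases e₂ : k = .done c
            · subst e₂; simp; omega
            · simp [e₁, e₂]
        omega
  intro s S v h
  have h0 : Rel N env (update aux c 0) s S := by rwa [← haux, update_eq_self]
  obtain ⟨n, v', S', hn, hx, h', hl⟩ := key (env c) 0 (by omega) s S v h0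
  have ha : S' (.aux c) = List.replicate (env c) true := by simpa using h'.aux c
  have hd : S' (.done c) = [] := by simpa using h'.done c
  refine ⟨n + (env c + 1), (none, v'.2), update (update S' (.done c)
    (List.replicate (env c) true ++ S' (.done c))) (.aux c) [], ?_, ?_, ?_, ?_⟩
  rotate_left 1
  · exact fun M emb exit hM =>
      (hx M emb exit hM).trans (runs_restore (by simp) hM (env c) v' S' ha)
  · refine ⟨?_, ?_, fun c' => ?_, fun c' => ?_, fun c' => ?_, fun a => ?_, fun a n => ?_⟩
    · simpa using h'.io
    · simpa using h'.bst
    · simpa using h'.todo c'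
    · by_cases hc : c' = c
      · subst hc
        simp [hd, haux]
      · simpa [hc] using h'.done c'
    · by_cases hc : c' = c
      · subst hc
        simp [haux]
      · simpa [hc] using h'.aux c'
    · simpa using h'.pos a
    · simpa using h'.arr a n
  · intro k
    have a₁ := hl k
    by_cases e₁ : k = .aux c
    · subst e₁; simp
    · by_cases e₂ : k = .done c
      · subst e₂; simp [hd]; omega
      · simp [e₁, e₂]; omega
  · have := Nat.mul_le_mul_right (t + 3) henv
    nlinarith

theorem simulates_seq {N : ℕ} {F G : Frag} {env aux : Ctr → ℕ} {f g : Store → Store} {t u : ℕ}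
    (hF : Simulates N F env aux f t) (hG : Simulates N G env aux g u) :
    Simulates N (F.seq G) env aux (fun s => g (f s)) (t + u) := by
  intro s S v h
  obtain ⟨n₁, v₁, S₁, hn₁, hx₁, h₁, hl₁⟩ := hF s S v h
  obtain ⟨n₂, v₂, S₂, hn₂, hx₂, h₂, hl₂⟩ := hG _ S₁ v₁ h₁
  refine ⟨n₁ + n₂, v₂, S₂, by omega, Frag.exec_seq hx₁ hx₂, h₂, fun k => ?_⟩
  have := hl₁ k
  have := hl₂ k
  omega

theorem Rel.pop {N : ℕ} {env aux : Ctr → ℕ} {s : Store} {S : Stk → List Bool}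
    (h : Rel N env aux s S) :
    Rel N env aux { s with bst := s.bst.tail } (update S .bst (S .bst).tail) :=
  ⟨by simpa using h.io, by simp [h.bst], by simpa using h.todo, by simpa using h.done,
    by simpa using h.aux, by simpa using h.pos, by simpa using h.arr⟩

theorem simulates_ite {N : ℕ} {F G : Frag} {env aux : Ctr → ℕ} {f g : Store → Store} {t u : ℕ}
    (hF : Simulates N F env aux f t) (hG : Simulates N G env aux g u) :
    Simulates N (F.ite G) env aux
      (fun s => if s.bst.headD false then f { s with bst := s.bst.tail }
        else g { s with bst := s.bst.tail }) (1 + t + u) := by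
  intro s S v h
  have hp : ∀ k, (update S .bst (S .bst).tail k).length ≤ (S k).length := by
    intro k
    by_cases e : k = .bst
    · subst e; simp
    · simp [e]
  by_cases hb : s.bst.headD false = true
  · obtain ⟨n₁, v₁, S₁, hn₁, hx₁, h₁, hl₁⟩ := hF _ _ ((S .bst).head?, v.2) h.pop
    refine ⟨1 + n₁, v₁, S₁, by omega, fun M emb exit hM => ?_, by simpa only [if_pos hb] using h₁,
      fun k => ?_⟩
    · refine (Runs.step ?_).trans (hx₁ M (fun l => emb (some (.inl l))) exit
        fun l => hM (some (.inl l)))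
      rw [← h.bst, List.headD_eq_head?_getD] at hb
      erw [hM]
      simp [TM2.stepAux, hb]
    · have := hl₁ k
      have := hp k
      omega
  · obtain ⟨n₁, v₁, S₁, hn₁, hx₁, h₁, hl₁⟩ := hG _ _ ((S .bst).head?, v.2) h.pop
    refine ⟨1 + n₁, v₁, S₁, by omega, fun M emb exit hM => ?_, by simpa only [if_neg hb] using h₁,
      fun k => ?_⟩
    · refine (Runs.step ?_).trans (hx₁ M (fun l => emb (some (.inr l))) exit
        fun l => hM (some (.inr l)))
      rw [← h.bst, List.headD_eq_head?_getD] at hb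
      erw [hM]
      simp [TM2.stepAux, hb]
    · have := hl₁ k
      have := hp k
      omega

end LoopProg

/-! ### Simulation of whole programs, and the machine -/

namespace LoopProg

open Turing Function

/-- The hypotheses say that no bit of a used counter is lent and that every counter to be looped
over is at zero. Entering `rep c` spoils the second condition for `c` only, and entering `times c`
spoils the first for `c` only; `WF` excludes exactly the bodies for which this would matter. -/
theorem simulates_compile (N : ℕ) (P : Prog) : P.WF → ∀ env aux : Ctr → ℕ, (∀ c, env c ≤ N) →
    (∀ c ∈ P.used, aux c = 0) → (∀ c ∈ P.looped, env c = 0) →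
    Simulates N (compile P) env aux (P.eval N env) (P.cost.eval N) := by
  induction P with
  | skip =>
    intro _ env aux _ _ _
    simp only [Prog.cost, Polynomial.eval_one]
    exact simulates_atom .skip (fun v _ => v) (fun _ S => S)
      (fun _ _ _ => rfl) (fun v s S h => h) (fun v S k => by omega)
  | const b =>
    intro _ env aux _ _ _
    simp only [Prog.cost, Polynomial.eval_one]
    refine simulates_atom (.const b) (fun v _ => v) (fun _ S => update S .bst (b :: S .bst))
      (fun _ _ _ => rfl) (fun v s S h => ?_) (fun v S k => ?_)
    · exact ⟨by simpa using h.io, by simp [h.bst, Prog.eval], by simpa using h.todo,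
        by simpa using h.done, by simpa using h.aux, by simpa using! h.pos, by simpa using! h.arr⟩
    · by_cases e : k = .bst
      · subst e; simp
      · simp [e]
  | op f =>
    intro _ env aux _ _ _
    simp only [Prog.cost, Polynomial.eval_one]
    refine simulates_atom (.op f) (fun v S => ((S .bst).head?, (S .bst).tail.head?))
      (fun _ S => update S .bst (f ((S .bst).headD false) ((S .bst).tail.headD false) ::
        (S .bst).tail.tail)) (fun _ _ _ => ?_) (fun v s S h => ?_) (fun v S k => ?_)
    · simp [stmtOf, TM2.stepAux]
    · exact ⟨by simpa using h.io, by simp [h.bst, Prog.eval], by simpa using h.todo,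
        by simpa using h.done, by simpa using h.aux, by simpa using! h.pos, by simpa using! h.arr⟩
    · by_cases e : k = .bst
      · subst e; simp; omega
      · simp [e]
  | get a =>
    intro _ env aux _ _ _
    simp only [Prog.cost, Polynomial.eval_one]
    refine simulates_atom (.get a) (fun v S => ((S (.rgt a)).head?, v.2))
      (fun _ S => update S .bst ((S (.rgt a)).headD false :: S .bst)) (fun _ _ _ => ?_)
      (fun v s S h => ?_) (fun v S k => ?_)
    · simp [stmtOf, TM2.stepAux]
    · refine ⟨by simpa using h.io, ?_, by simpa using h.todo,
        by simpa using h.done, by simpa using h.aux, by simpa using! h.pos, by simpa using! h.arr⟩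
      have := h.arr a (s.pos a)
      rw [← h.pos a, List.getD_append_right _ _ _ _ (by simp)] at this
      simp only [List.length_reverse, Nat.sub_self] at this
      simp only [update_self, Prog.eval, h.bst, ← h.pos a, ← this]
      cases S (.rgt a) <;> simp
    · by_cases e : k = .bst
      · subst e; simp
      · simp [e]
  | put a =>
    intro _ env aux _ _ _
    simp only [Prog.cost, Polynomial.eval_one]
    refine simulates_atom (.put a) (fun v S => ((S .bst).head?, v.2))
      (fun _ S => update (update S .bst (S .bst).tail) (.rgt a)
        ((S .bst).headD false :: (S (.rgt a)).tail)) (fun _ _ _ => ?_)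
      (fun v s S h => ?_) (fun v S k => ?_)
    · simp [stmtOf, TM2.stepAux]
    · refine ⟨by simpa using h.io, by simp [h.bst, Prog.eval], by simpa using h.todo,
        by simpa using h.done, by simpa using h.aux, by simpa using! h.pos, fun a' n => ?_⟩
      by_cases e : a' = a
      · subst e
        simp only [ne_eq, reduceCtorEq, not_false_eq_true, update_of_ne, update_self, Prog.eval,
          getD_append_cons_tail, h.arr, List.length_reverse, h.pos, update_apply, h.bst]
      · simpa [e, Prog.eval] using h.arr a' n
    · by_cases e : k = .rgt a
      · subst e; simp
      · by_cases e' : k = .bst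
        · subst e'; simp; omega
        · simp [e, e']
  | right a =>
    intro _ env aux _ _ _
    simp only [Prog.cost, Polynomial.eval_one]
    refine simulates_atom (.right a) (fun v S => ((S (.rgt a)).head?, v.2))
      (fun _ S => update (update S (.rgt a) (S (.rgt a)).tail) (.lft a)
        ((S (.rgt a)).head?.getD false :: S (.lft a))) (fun _ _ _ => ?_)
      (fun v s S h => ?_) (fun v S k => ?_)
    · simp [stmtOf, TM2.stepAux]
    · refine ⟨by simpa using h.io, by simpa using! h.bst, by simpa using h.todo,
        by simpa using h.done, by simpa using h.aux, fun a' => ?_, fun a' n => ?_⟩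
      · by_cases e : a' = a
        · subst e
          simp [Prog.eval, h.pos]
        · simpa [e, Prog.eval] using h.pos a'
      · by_cases e : a' = a
        · subst e
          have := getD_reverse_cons_tail (S (.lft a')) (S (.rgt a')) n
          simpa only [ne_eq, reduceCtorEq, not_false_eq_true, update_of_ne, update_self, h.arr]
        · simpa [e, Prog.eval] using h.arr a' n
    · by_cases e : k = .lft a
      · subst e; simp
      · by_cases e' : k = .rgt a
        · subst e'; simp; omega
        · simp [e, e']
  | left a =>
    intro _ env aux _ _ _
    simp only [Prog.cost, Polynomial.eval_one]
    refine simulates_atom (.left a) (fun v S => ((S (.lft a)).head?, v.2))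
      (fun _ S => if (S (.lft a)).head?.isSome then
        update (update S (.lft a) (S (.lft a)).tail) (.rgt a)
        ((S (.lft a)).head?.getD false :: S (.rgt a)) else S) (fun _ v S => ?_)
      (fun v s S h => ?_) (fun v S k => ?_)
    · cases e : S (.lft a) with
      | nil =>
        have : update S (.lft a) [] = S := by rw [← e, update_eq_self]
        simp [stmtOf, TM2.stepAux, e, this]
      | cons x l => simp [stmtOf, TM2.stepAux, e]
    · cases e : S (.lft a) with
      | nil =>
        -- At the left end the machine leaves its stacks alone, in agreement with truncated
        -- subtraction on positions.
        have hp : s.pos a = 0 := by simp [← h.pos, e]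
        have : Prog.eval N (.left a) env s = s := by
          simp only [Prog.eval, hp, Nat.zero_sub]
          rw [← hp, update_eq_self]
        rw [this]
        simpa using h
      | cons x l =>
        simp only [List.head?_cons, Option.isSome_some, if_true]
        refine ⟨by simpa using h.io, by simpa using! h.bst, by simpa using h.todo,
          by simpa using h.done, by simpa using h.aux, fun a' => ?_, fun a' n => ?_⟩
        · by_cases e' : a' = a
          · subst e'
            simp [Prog.eval, ← h.pos, e]
          · simpa [e', Prog.eval] using h.pos a'
        · by_cases e' : a' = a
          · subst e'
            have := h.arr a' n
            rw [e] at this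
            simpa using! this
          · simpa [e', Prog.eval] using h.arr a' n
    · split_ifs
      · by_cases e : k = .rgt a
        · subst e; simp
        · by_cases e' : k = .lft a
          · subst e'; simp; omega
          · simp [e, e']
      · omega
  | seq P Q hP hQ =>
    intro hw env aux henv haux hz
    simp only [Prog.used, Prog.looped, List.mem_append] at haux hz
    rw [Prog.cost, Polynomial.eval_add]
    exact simulates_seq (f := P.eval N env) (g := Q.eval N env)
      (hP hw.1 env aux henv (fun c h => haux c (.inl h)) fun c h => hz c (.inl h))
      (hQ hw.2 env aux henv (fun c h => haux c (.inr h)) fun c h => hz c (.inr h))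
  | ite P Q hP hQ =>
    intro hw env aux henv haux hz
    simp only [Prog.used, Prog.looped, List.mem_append] at haux hz
    rw [Prog.cost, Polynomial.eval_add, Polynomial.eval_add, Polynomial.eval_one]
    exact simulates_ite (f := P.eval N env) (g := Q.eval N env)
      (hP hw.1 env aux henv (fun c h => haux c (.inl h)) fun c h => hz c (.inl h))
      (hQ hw.2 env aux henv (fun c h => haux c (.inr h)) fun c h => hz c (.inr h))
  | rep c P hP =>
    intro hw env aux henv haux hz
    simp only [Prog.used, Prog.looped, List.mem_cons] at haux hz
    rw [Prog.cost]
    simp only [Polynomial.eval_add, Polynomial.eval_mul, Polynomial.eval_X, Polynomial.eval_ofNat]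
    refine simulates_rep (hz c (.inl rfl)) (haux c (.inl rfl)) fun i hi => ?_
    refine hP hw.2 _ aux (fun c' => ?_) (fun c' h => haux c' (.inr h)) fun c' h => ?_
    · by_cases e : c' = c
      · subst e; simpa using hi.le
      · simpa [e] using henv c'
    · have : c' ≠ c := fun e => hw.1 (e ▸ h)
      simpa [this] using hz c' (.inr h)
  | times c P hP =>
    intro hw env aux henv haux hz
    simp only [Prog.used, Prog.looped, List.mem_cons] at haux hz
    rw [Prog.cost]
    simp only [Polynomial.eval_add, Polynomial.eval_mul, Polynomial.eval_X, Polynomial.eval_ofNat]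
    refine simulates_times (henv c) (haux c (.inl rfl)) fun i => ?_
    refine hP hw.2 env _ henv (fun c' h => ?_) hz
    have : c' ≠ c := fun e => hw.1 (e ▸ h)
    simpa [this] using haux c' (.inr h)

/-- Pop every stack of a list, and record in the first buffer whether a bit was found. -/
def popAll {Λ : Type} (ks : List Stk) (q : MStmt Λ) : MStmt Λ :=
  ks.foldr (fun k q => .pop k (fun v o => (v.1.or o, v.2)) q) q

/-- All stacks are popped within one machine step, so clearing takes as many steps as the longest
stack has bits, plus one to notice that all are empty. -/
theorem stepAux_popAll {Λ : Type} (q : MStmt Λ) (ks : List Stk) (hks : ks.Nodup) :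
    ∀ v S, ∃ b : Option Bool, (b = none ↔ v.1 = none ∧ ∀ k ∈ ks, S k = []) ∧
      TM2.stepAux (popAll ks q) v S =
        TM2.stepAux q (b, v.2) (fun k => if k ∈ ks then (S k).tail else S k) := by
  induction ks with
  | nil => exact fun v S => ⟨v.1, by simp, by simp [popAll]⟩
  | cons k ks ih =>
    intro v S
    rw [List.nodup_cons] at hks
    obtain ⟨b, hb, he⟩ := ih hks.2 (v.1.or (S k).head?, v.2) (update S k (S k).tail)
    refine ⟨b, ?_, ?_⟩
    · rw [hb]
      have : ∀ k' ∈ ks, update S k (S k).tail k' = S k' := fun k' hk' =>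
        update_of_ne (by rintro rfl; exact hks.1 hk') _ _
      simp +contextual [this, and_assoc]
    · have : popAll (k :: ks) q = .pop k (fun v o => (v.1.or o, v.2)) (popAll ks q) := rfl
      rw [this, TM2.stepAux, he]
      congr 1
      funext k'
      by_cases e : k' = k
      · subst e; simp [hks.1]
      · simp [e]

/-- Push a bit on every stack of counters in a list. -/
def pushTodo {Λ : Type} (cs : List Ctr) (q : MStmt Λ) : MStmt Λ :=
  cs.foldr (fun c q => .push (.todo c) (fun _ => true) q) q

/-- The effect of `pushTodo`. -/
def consTodo (cs : List Ctr) (S : Stk → List Bool) : Stk → List Bool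
  | .todo c => if c ∈ cs then true :: S (.todo c) else S (.todo c)
  | k => S k

theorem stepAux_pushTodo {Λ : Type} (q : MStmt Λ) (v : Buf) (cs : List Ctr) (hcs : cs.Nodup) :
    ∀ S, TM2.stepAux (pushTodo cs q) v S = TM2.stepAux q v (consTodo cs S) := by
  induction cs with
  | nil =>
    intro S
    have : consTodo [] S = S := by
      funext k; cases k <;> simp [consTodo]
    simp [this, pushTodo]
  | cons c cs ih =>
    intro S
    rw [List.nodup_cons] at hcs
    have : pushTodo (c :: cs) q = .push (.todo c) (fun _ => true) (pushTodo cs q) := rfl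
    rw [this, TM2.stepAux, ih hcs.2]
    congr 1
    funext k
    cases k with
    | todo c' =>
      by_cases e : c' = c
      · subst e; simp [consTodo, hcs.1]
      · simp [consTodo, e]
    | _ => simp [consTodo]

/-- The machine for a loop program: it moves the input to the array `0` and counts its bits,
runs the program, clears all stacks and outputs the top of the stack of bits. -/
noncomputable def machine (P : Prog) : FinTM2 where
  K := Stk
  k₀ := .io
  k₁ := .io
  Γ _ := Bool
  Λ := Fin 3 ⊕ (compile P).Lab
  main := .inl 0
  σ := Buf
  initialState := (none, none)
  m l :=
    match l with
    | .inl 0 =>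
      .pop .io (fun v o => (o, v.2)) <|
        .branch (fun v => v.1.isSome)
          (.push (.lft 0) (fun v => v.1.getD false) <|
            pushTodo Finset.univ.toList <| .goto fun _ => .inl 0)
          (.goto fun _ => .inr (compile P).entry)
    | .inl 1 => .pop .bst (fun v o => (v.1, o)) <| .goto fun _ => .inl 2
    | .inl 2 =>
      .load (fun v => (none, v.2)) <| popAll Finset.univ.toList <|
        .branch (fun v => v.1.isSome) (.goto fun _ => .inl 2)
          (.push .io (fun v => v.2.getD false) <| .load (fun _ => (none, none)) .halt)
    | .inr l => (compile P).code .inr (.inl 1) l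

/-- The store in which the program of `machine P` starts. -/
def initStore (l : List Bool) : Store where
  bst := []
  arr a n := if a = 0 then l.getD n false else false
  pos a := if a = 0 then l.length else 0

/-- Each input bit also puts one bit on every `todo` stack, which makes the loop bound equal to the
length of the input. The head of array `0` ends up behind the last input bit. -/
theorem runs_init (P : Prog) (l : List Bool) : ∀ v S, S .io = l →
    ∃ v', Runs (machine P).m (l.length + 1) ⟨some (.inl 0), v, S⟩
      ⟨some (.inr (compile P).entry), v', fun k => match k with
        | .io => []
        | .lft a => if a = 0 then l.reverse ++ S (.lft a) else S (.lft a)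
        | .todo c => List.replicate l.length true ++ S (.todo c)
        | k => S k⟩ := by
  induction l with
  | nil =>
    intro v S hS
    refine ⟨(none, v.2), Runs.step ?_⟩
    simp only [machine, TM2.stepAux, hS]
    simp only [List.head?_nil, Option.isSome_none, cond_false, List.tail_nil]
    congr 1
    funext k
    cases k <;> simp
  | cons x l ih =>
    intro v S hS
    obtain ⟨v', h⟩ := ih (some x, v.2) (consTodo Finset.univ.toList
      (update (update S .io l) (.lft 0) (x :: S (.lft 0)))) (by simp [consTodo])
    refine ⟨v', ?_⟩
    rw [List.length_cons, show l.length + 1 + 1 = 1 + (l.length + 1) by ring]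
    have hs := Runs.trans (Runs.step (M := (machine P).m) (l := .inl 0) (v := v) (S := S) ?_) h
    · convert hs using 2
      funext k
      cases k with
      | lft a =>
        by_cases e : a = 0
        · subst e; simp [consTodo]
        · simp [consTodo, e]
      | todo c =>
        simp only [consTodo, Finset.mem_toList, Finset.mem_univ, if_true, ne_eq, reduceCtorEq,
          not_false_eq_true, update_of_ne, List.replicate_succ']
        simp
      | _ => simp [consTodo]
    · simp only [machine, TM2.stepAux, hS]
      simp only [List.head?_cons, Option.isSome_some, cond_true, List.tail_cons]
      rw [stepAux_pushTodo _ _ _ (Finset.nodup_toList _)]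
      simp [TM2.stepAux]

theorem runs_clear (P : Prog) (b : Bool) (m : ℕ) : ∀ v S, v.2.getD false = b →
    (∀ k, (S k).length ≤ m) → ∃ n ≤ m + 1, Runs (machine P).m n ⟨some (.inl 2), v, S⟩
      ⟨none, (none, none), fun k => if k = .io then [b] else []⟩ := by
  induction m with
  | zero =>
    intro v S hv hS
    refine ⟨1, le_rfl, Runs.step ?_⟩
    obtain ⟨o, ho, he⟩ := stepAux_popAll (.branch (fun v => v.1.isSome) (.goto fun _ => .inl 2)
      (.push .io (fun v => v.2.getD false) <| .load (fun _ => (none, none)) .halt) :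
        MStmt (Fin 3 ⊕ (compile P).Lab))
      Finset.univ.toList (Finset.nodup_toList _) (none, v.2) S
    have hS' : ∀ k, S k = [] := fun k => List.length_eq_zero_iff.1 (Nat.le_zero.1 (hS k))
    have : o = none := by rw [ho]; simp [hS']
    subst this
    simp only [machine]
    rw [TM2.stepAux, he]
    simp only [TM2.stepAux, Option.isSome_none, cond_false, hv]
    congr 1
    funext k
    by_cases e : k = .io
    · subst e; simp [hS']
    · simp [e, hS']
  | succ m ih =>
    intro v S hv hS
    obtain ⟨o, ho, he⟩ := stepAux_popAll (.branch (fun v => v.1.isSome) (.goto fun _ => .inl 2)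
      (.push .io (fun v => v.2.getD false) <| .load (fun _ => (none, none)) .halt) :
        MStmt (Fin 3 ⊕ (compile P).Lab))
      Finset.univ.toList (Finset.nodup_toList _) (none, v.2) S
    cases o with
    | none =>
      have hS' : ∀ k, S k = [] := by simpa using ho
      refine ⟨1, by omega, Runs.step ?_⟩
      simp only [machine]
      rw [TM2.stepAux, he]
      simp only [TM2.stepAux, Option.isSome_none, cond_false, hv]
      congr 1
      funext k
      by_cases e : k = .io
      · subst e; simp [hS']
      · simp [e, hS']
    | some x =>
      obtain ⟨n, hn, h⟩ := ih (some x, v.2) (fun k => (S k).tail) hv fun k => by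
        have := hS k
        simp only [List.length_tail]
        omega
      refine ⟨1 + n, by omega, (Runs.step ?_).trans h⟩
      simp only [machine]
      rw [TM2.stepAux, he]
      simp [TM2.stepAux]

theorem machine_outputs (P : Prog) (hP : P.WF) (l : List Bool) :
    Nonempty (TM2OutputsInTime (machine P) l
      (some [(P.eval l.length (fun _ => 0) (initStore l)).bst.headD false])
      (2 * l.length + 2 * P.cost.eval l.length + 3)) := by
  obtain ⟨v₁, h₁⟩ := runs_init P l (none, none)
    (fun k => if k = .io then l else []) (by simp)
  obtain ⟨n, v₂, S₂, hn, hx, hr, hl⟩ := simulates_compile l.length P hP (fun _ => 0) (fun _ => 0)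
    (by simp) (by simp) (by simp) (initStore l) (fun k => match k with
        | .io => []
        | .lft a => if a = 0 then l.reverse ++ [] else []
        | .todo c => List.replicate l.length true ++ []
        | _ => []) v₁ (by
      refine ⟨rfl, rfl, by simp, by simp, by simp, fun a => ?_, fun a n => ?_⟩
      · by_cases e : a = 0 <;> simp [e, initStore]
      · by_cases e : a = 0 <;> simp [e, initStore])
  have h₂ := hx (machine P).m .inr (.inl 1) fun _ => rfl
  have h₃ : Runs (machine P).m 1 ⟨some (.inl 1), v₂, S₂⟩ ⟨some (.inl 2), (v₂.1, (S₂ .bst).head?),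
      update S₂ .bst (S₂ .bst).tail⟩ := Runs.step rfl
  obtain ⟨m, hm, h₄⟩ := runs_clear P ((S₂ .bst).head?.getD false) (l.length + n)
    (v₂.1, (S₂ .bst).head?) (update S₂ .bst (S₂ .bst).tail) rfl (fun k => by
      have : (S₂ k).length ≤ l.length + n := by
        refine (hl k).trans (Nat.add_le_add_right ?_ _)
        cases k with
        | lft a => by_cases e : a = 0 <;> simp [e]
        | _ => simp
      by_cases e : k = .bst
      · subst e; simp; omega
      · simpa [e] using this)
  -- Loading takes `l.length + 1` steps, the program `n`, saving the answer one. Stacks have at most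
  -- `l.length + n` bits by then, so clearing takes `m ≤ l.length + n + 1` steps.
  suffices Runs (machine P).m (l.length + 1 + n + 1 + m) (initList (machine P) l)
      (haltList (machine P)
      [(P.eval l.length (fun _ => 0) (initStore l)).bst.headD false]) from
    ⟨⟨⟨_, this⟩, show l.length + 1 + n + 1 + m ≤ _ by omega⟩⟩
  have hs : (fun k => match k with
        | .io => []
        | .lft a => if a = 0 then l.reverse ++ (fun k => if k = Stk.io then l else []) (.lft a)
            else (fun k => if k = Stk.io then l else []) (.lft a)
        | .todo c => List.replicate l.length true ++
            (fun k => if k = Stk.io then l else []) (.todo c)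
        | k => (fun k => if k = Stk.io then l else []) k : Stk → List Bool) =
      fun k => match k with
        | .io => []
        | .lft a => if a = 0 then l.reverse ++ [] else []
        | .todo c => List.replicate l.length true ++ []
        | _ => [] := by
    funext k
    cases k <;> simp
  rw [hs] at h₁
  have := ((h₁.trans h₂).trans h₃).trans h₄
  have hi : initList (machine P) l = ⟨some (.inl 0), (none, none),
      fun k : Stk => if k = .io then l else []⟩ := by
    unfold initList
    congr 1
  have hh : haltList (machine P)
      [(P.eval l.length (fun _ => 0) (initStore l)).bst.headD false] =
      ⟨none, (none, none), fun k : Stk => if k = .io then [(S₂ .bst).head?.getD false] else []⟩ := by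
    rw [← hr.bst, List.headD_eq_head?_getD]
    unfold haltList
    congr 1
  rw [hi, hh]
  exact this

theorem eval_le_eval (p : Polynomial ℕ) {m n : ℕ} (h : m ≤ n) : p.eval m ≤ p.eval n := by
  rw [Polynomial.eval_eq_sum, Polynomial.eval_eq_sum]
  exact Finset.sum_le_sum fun i _ => Nat.mul_le_mul_left _ (Nat.pow_le_pow_left h i)

end LoopProg

/-! ### Index tuples and evaluation of first-order formulas -/

namespace LoopProg

open Turing Function

namespace Prog

/-- Repeat a program `N ^ j` times, with reserved counters. -/
def power (P : Prog) : ℕ → Prog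
  | 0 => P
  | j + 1 => rep (Fin.ofNat 16 (13 + j)) (power P j)

/-- Repeat a program as often as the address of an index tuple says. -/
def walk (P : Prog) : List Ctr → Prog
  | [] => skip
  | x :: xs => seq (times x (power P xs.length)) (walk P xs)

/-- Push the bit of an array at an index tuple. -/
def read (a : Arr) (xs : List Ctr) : Prog :=
  seq (walk (right a) xs) (seq (get a) (walk (left a) xs))

/-- Nested loops. -/
def nest (xs : List Ctr) (P : Prog) : Prog := xs.foldr rep P

end Prog

/-- The address of an index tuple in an array: its value in base `N`. -/
def addr (N : ℕ) (env : Ctr → ℕ) : List Ctr → ℕ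
  | [] => 0
  | x :: xs => env x * N ^ xs.length + addr N env xs

/-- The counter values with the digits of `m` in base `N` at the counters `xs`. -/
def point (N : ℕ) (env : Ctr → ℕ) : List Ctr → ℕ → Ctr → ℕ
  | [], _ => env
  | x :: xs, m => point N (update env x (m / N ^ xs.length)) xs (m % N ^ xs.length)

theorem point_of_notMem {N : ℕ} {x : Ctr} (xs : List Ctr) (hx : x ∉ xs) :
    ∀ env m, point N env xs m x = env x := by
  induction xs with
  | nil => exact fun _ _ => rfl
  | cons y xs ih =>
    intro env m
    rw [List.mem_cons, not_or] at hx
    rw [point, ih hx.2, update_of_ne hx.1]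

theorem addr_point {N : ℕ} (xs : List Ctr) (hxs : xs.Nodup) :
    ∀ env, ∀ m < N ^ xs.length, addr N (point N env xs m) xs = m := by
  induction xs with
  | nil =>
    intro env m hm
    simp only [List.length_nil, pow_zero, Nat.lt_one_iff] at hm
    simp [addr, hm]
  | cons x xs ih =>
    intro env m hm
    rw [List.nodup_cons] at hxs
    have hN : 0 < N ^ xs.length := by
      rcases Nat.eq_zero_or_pos (N ^ xs.length) with h | h
      · rw [List.length_cons, pow_succ, h] at hm; omega
      · exact h
    rw [addr, point, ih hxs.2 _ _ (Nat.mod_lt _ hN), point_of_notMem _ hxs.1, update_self,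
      Nat.div_add_mod']

theorem foldl_range_mul {α : Type*} (f : α → ℕ → α) (M : ℕ) (s : α) : ∀ N : ℕ,
    (List.range (N * M)).foldl f s =
      (List.range N).foldl (fun s i => (List.range M).foldl (fun s m => f s (i * M + m)) s) s
  | 0 => by simp
  | N + 1 => by
    rw [Nat.succ_mul, List.range_add, List.foldl_append, foldl_range_mul f M s N,
      List.range_succ, List.foldl_append, List.foldl_map]
    rfl

theorem foldl_range_congr {α : Type*} {f g : α → ℕ → α} {M : ℕ} (h : ∀ s, ∀ m < M, f s m = g s m)
    (s : α) : (List.range M).foldl f s = (List.range M).foldl g s :=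
  List.foldl_ext _ _ _ fun a m hm => h a m (List.mem_range.1 hm)

/-- The loops visit the tuples in lexicographic order, which is the order of their addresses. A head
that moves right once per round thus always stands at the address of the current tuple. -/
theorem eval_nest {N : ℕ} (P : Prog) (xs : List Ctr) : ∀ env s,
    (Prog.nest xs P).eval N env s =
      (List.range (N ^ xs.length)).foldl (fun s m => P.eval N (point N env xs m) s) s := by
  induction xs with
  | nil => intro env s; simp [Prog.nest, point]
  | cons x xs ih =>
    intro env s
    rw [List.length_cons, pow_succ', foldl_range_mul]
    change (Prog.rep x (Prog.nest xs P)).eval N env s = _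
    rw [Prog.eval]
    congr 1
    funext s i
    rw [ih]
    refine foldl_range_congr (fun s m hm => ?_) s
    rw [point, Nat.mul_add_mod_of_lt hm, mul_comm i, Nat.mul_add_div (by omega),
      Nat.div_eq_of_lt hm, add_zero]

theorem foldl_range_const {α : Type*} (f : α → α) (s : α) (n : ℕ) :
    (List.range n).foldl (fun s _ => f s) s = f^[n] s := by
  induction n with
  | zero => rfl
  | succ n ih => rw [List.range_succ, List.foldl_append, ih, iterate_succ_apply']; rfl

theorem eval_power {N : ℕ} {P : Prog} {f : Store → Store} (hP : ∀ env, P.eval N env = f) (j : ℕ) :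
    ∀ env, (P.power j).eval N env = f^[N ^ j] := by
  induction j with
  | zero => intro env; simp [Prog.power, hP]
  | succ j ih =>
    intro env
    funext s
    simp only [Prog.power, Prog.eval, ih]
    rw [foldl_range_const, pow_succ, iterate_mul]

theorem eval_walk {N : ℕ} {P : Prog} {f : Store → Store} (hP : ∀ env, P.eval N env = f)
    (xs : List Ctr) (env : Ctr → ℕ) : (P.walk xs).eval N env = f^[addr N env xs] := by
  induction xs with
  | nil => rfl
  | cons x xs ih =>
    funext s
    simp only [Prog.walk, Prog.eval, ih, addr, eval_power hP]
    rw [add_comm, iterate_add_apply, mul_comm, iterate_mul]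

theorem iterate_right {N : ℕ} {env : Ctr → ℕ} (a : Arr) (n : ℕ) (s : Store) :
    ((Prog.right a).eval N env)^[n] s = { s with pos := update s.pos a (s.pos a + n) } := by
  induction n with
  | zero => simp
  | succ n ih => rw [iterate_succ_apply', ih]; simp [Prog.eval, add_assoc]

theorem iterate_left {N : ℕ} {env : Ctr → ℕ} (a : Arr) (n : ℕ) (s : Store) :
    ((Prog.left a).eval N env)^[n] s = { s with pos := update s.pos a (s.pos a - n) } := by
  induction n with
  | zero => simp
  | succ n ih => rw [iterate_succ_apply', ih]; simp [Prog.eval, Nat.sub_sub]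

theorem eval_read {N : ℕ} {env : Ctr → ℕ} (a : Arr) (xs : List Ctr) (s : Store) :
    (Prog.read a xs).eval N env s =
      { s with bst := s.arr a (s.pos a + addr N env xs) :: s.bst } := by
  simp only [Prog.read, Prog.eval]
  rw [eval_walk (P := .right a) (f := (Prog.right a).eval N env) (fun _ => rfl),
    eval_walk (P := .left a) (f := (Prog.left a).eval N env) (fun _ => rfl), iterate_right,
    iterate_left]
  simp

/-- First-order formulas over the arrays, as relations on the numbers below `N`. -/
inductive Fm
  | rel (a : Arr) (xs : List Ctr)
  | neg (φ : Fm)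
  | and (φ ψ : Fm)
  | or (φ ψ : Fm)
  | ex (x : Ctr) (φ : Fm)

namespace Fm

/-- The truth of a formula. -/
def Sat (N : ℕ) (arr : Arr → ℕ → Bool) : Fm → (Ctr → ℕ) → Prop
  | rel a xs, env => arr a (addr N env xs) = true
  | neg φ, env => ¬ Sat N arr φ env
  | and φ ψ, env => Sat N arr φ env ∧ Sat N arr ψ env
  | or φ ψ, env => Sat N arr φ env ∨ Sat N arr ψ env
  | ex x φ, env => ∃ i < N, Sat N arr φ (update env x i)

/-- The arrays that occur in a formula. -/
def arrs : Fm → List Arr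
  | rel a _ => [a]
  | neg φ => arrs φ
  | and φ ψ => arrs φ ++ arrs ψ
  | or φ ψ => arrs φ ++ arrs ψ
  | ex _ φ => arrs φ

/-- A program that pushes the truth value of a formula. -/
def comp : Fm → Prog
  | rel a xs => .read a xs
  | neg φ => .seq (comp φ) (.seq (.const true) (.op fun _ y => !y))
  | and φ ψ => .seq (comp φ) (.seq (comp ψ) (.op fun x y => x && y))
  | or φ ψ => .seq (comp φ) (.seq (comp ψ) (.op fun x y => x || y))
  | ex x φ => .seq (.const false) (.rep x (.seq (comp φ) (.op fun x y => x || y)))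

theorem sat_congr {N : ℕ} {arr arr' : Arr → ℕ → Bool} (φ : Fm) :
    (∀ a ∈ φ.arrs, arr a = arr' a) → ∀ env, φ.Sat N arr env ↔ φ.Sat N arr' env := by
  induction φ with
  | rel a xs => intro h env; simp [Sat, h a (by simp [arrs])]
  | neg φ ih => intro h env; simp [Sat, ih h]
  | and φ ψ ih₁ ih₂ | or φ ψ ih₁ ih₂ =>
    intro h env
    simp only [arrs, List.mem_append] at h
    rw [Sat, Sat, ih₁ fun a ha => h a (.inl ha), ih₂ fun a ha => h a (.inr ha)]
  | ex x φ ih => intro h env; simp [Sat, ih h]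

end Fm

/-- The arrays as seen from the head positions. -/
def Store.view (s : Store) (a : Arr) (n : ℕ) : Bool := s.arr a (s.pos a + n)

open Classical in
/-- The truth value of a formula. -/
noncomputable def Fm.val (N : ℕ) (arr : Arr → ℕ → Bool) (φ : Fm) (env : Ctr → ℕ) : Bool :=
  decide (φ.Sat N arr env)

theorem Fm.val_eq_true {N : ℕ} {arr : Arr → ℕ → Bool} {φ : Fm} {env : Ctr → ℕ} :
    φ.val N arr env = true ↔ φ.Sat N arr env := by
  simp [Fm.val]

/-- The program restores all heads and only pushes one bit, so it can be used inside loops and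
larger formulas without side effects. -/
theorem eval_comp {N : ℕ} (φ : Fm) : ∀ env s,
    φ.comp.eval N env s = { s with bst := φ.val N s.view env :: s.bst } := by
  induction φ with
  | rel a xs =>
    intro env s
    rw [Fm.comp, eval_read]
    congr 2
    rw [Bool.eq_iff_iff, Fm.val_eq_true]
    rfl
  | neg φ ih =>
    intro env s
    simp only [Fm.comp, Prog.eval, ih, List.headD_cons, List.tail_cons]
    congr 2
    rw [Bool.eq_iff_iff, Fm.val_eq_true, Fm.Sat, ← Fm.val_eq_true]
    simp
  | and φ ψ ih₁ ih₂ =>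
    intro env s
    simp only [Fm.comp, Prog.eval, ih₁, ih₂, List.headD_cons, List.tail_cons]
    congr 2
    rw [Bool.eq_iff_iff, Fm.val_eq_true, Fm.Sat, ← Fm.val_eq_true, ← Fm.val_eq_true,
      Bool.and_eq_true, and_comm]
    rfl
  | or φ ψ ih₁ ih₂ =>
    intro env s
    simp only [Fm.comp, Prog.eval, ih₁, ih₂, List.headD_cons, List.tail_cons]
    congr 2
    rw [Bool.eq_iff_iff, Fm.val_eq_true, Fm.Sat, ← Fm.val_eq_true, ← Fm.val_eq_true,
      Bool.or_eq_true, or_comm]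
    rfl
  | ex x φ ih =>
    intro env s
    simp only [Fm.comp, Prog.eval, ih, List.headD_cons, List.tail_cons]
    -- After `n` rounds the top bit is the disjunction of the instances for values below `n`.
    suffices ∀ n, ∃ b : Bool, (b = true ↔ ∃ i < n, φ.Sat N s.view (update env x i)) ∧
        (List.range n).foldl (fun (s : Store) i => ({ s with bst :=
          (φ.val N s.view (update env x i) || s.bst.headD false) :: s.bst.tail } : Store))
        { s with bst := false :: s.bst } = { s with bst := b :: s.bst } by
      obtain ⟨b, hb, h⟩ := this N
      rw [h]
      congr 2
      rw [Bool.eq_iff_iff, hb, Fm.val_eq_true]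
      rfl
    intro n
    induction n with
    | zero => exact ⟨false, by simp, rfl⟩
    | succ n ihn =>
      obtain ⟨b, hb, h⟩ := ihn
      refine ⟨φ.val N s.view (update env x n) || b, ?_, ?_⟩
      · rw [Bool.or_eq_true, hb, Fm.val_eq_true, Nat.exists_lt_succ_right, or_comm]
      · rw [List.range_succ, List.foldl_append, h]
        rfl

end LoopProg

/-! ### Programs that fill arrays -/

namespace LoopProg

open Turing Function

namespace Prog

/-- Store the relation that a formula defines in an array that does not occur in it. -/
def fill (a : Arr) (xs : List Ctr) (φ : Fm) : Prog :=
  seq (nest xs (seq φ.comp (seq (put a) (right a)))) (nest xs (left a))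

/-- Store the relation that a formula defines in an array; the array `19` is overwritten. -/
def set (a : Arr) (xs : List Ctr) (φ : Fm) : Prog :=
  seq (fill 19 xs φ) (fill a xs (.rel 19 xs))

/-- Read the bits of an array from the input, one for each tuple that satisfies a formula. -/
def load (a : Arr) (xs : List Ctr) (φ : Fm) : Prog :=
  seq (nest xs (seq φ.comp
    (seq (ite (seq (get 0) (right 0)) (const false)) (seq (put a) (right a))))) (nest xs (left a))

/-- Read a number in unary from the input. -/
def unary (a : Arr) : Prog :=
  seq (rep 0 (seq (get 0)
    (ite (seq (const true) (seq (put a) (seq (right a) (right 0)))) skip)))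
    (seq (right 0) (rep 0 (left a)))

/-- Store the equality relation in an array. -/
def diag (a : Arr) : Prog :=
  rep 0 (seq (walk (right a) [0, 0]) (seq (const true) (seq (put a) (walk (left a) [0, 0]))))

end Prog

theorem eval_nest_left {N : ℕ} (a : Arr) (xs : List Ctr) (env : Ctr → ℕ) (s : Store) :
    (Prog.nest xs (.left a)).eval N env s =
      { s with pos := update s.pos a (s.pos a - N ^ xs.length) } := by
  rw [eval_nest, ← iterate_left (N := N) (env := env), ← foldl_range_const]
  rfl

/-- Formulas read arrays relative to the heads, and the head of `a` moves during the loop; since `a`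
does not occur in `φ`, every round still sees the original view. -/
theorem eval_fill {N : ℕ} {a : Arr} {xs : List Ctr} {φ : Fm} {s : Store} (ha : a ∉ φ.arrs)
    (h0 : s.pos a = 0) (env : Ctr → ℕ) :
    (Prog.fill a xs φ).eval N env s = { s with
      arr := update s.arr a fun n =>
        if n < N ^ xs.length then φ.val N s.view (point N env xs n) else s.arr a n } := by
  have key : ∀ M, (List.range M).foldl (fun s m => (Prog.seq φ.comp (.seq (.put a)
      (.right a))).eval N (point N env xs m) s) s = { s with
        arr := update s.arr a fun n =>
          if n < M then φ.val N s.view (point N env xs n) else s.arr a n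
        pos := update s.pos a M } := by
    intro M
    induction M with
    | zero =>
      have : update s.pos a 0 = s.pos := by rw [← h0, update_eq_self]
      simp [this]
    | succ M ih =>
      rw [List.range_succ, List.foldl_append, ih]
      simp only [List.foldl_cons, List.foldl_nil, Prog.eval, eval_comp]
      ext1
      · rfl
      · simp only [update_idem, update_self, List.headD_cons]
        congr 1
        funext n
        rw [update_apply]
        by_cases e : n = M
        · subst e
          rw [if_pos rfl, if_pos (Nat.lt_succ_self _), Bool.eq_iff_iff, Fm.val_eq_true,
            Fm.val_eq_true]
          refine φ.sat_congr (fun b hb => ?_) _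
          have : b ≠ a := fun e => ha (e ▸ hb)
          funext n
          simp [Store.view, this]
        · rw [if_neg e]
          congr 1
          simp only [eq_iff_iff]
          omega
      · simp
  rw [Prog.fill, Prog.eval, eval_nest_left, eval_nest, key]
  simp [← h0]

/-- The detour through array `19` allows `φ` to mention `a` itself, as the rounds of a fixed-point
iteration require: all old values are read before any is overwritten. -/
theorem eval_set {N : ℕ} {a : Arr} {xs : List Ctr} {φ : Fm} {s : Store} (ha : a ≠ 19)
    (hφ : 19 ∉ φ.arrs) (hxs : xs.Nodup) (h0 : ∀ a ≠ 0, s.pos a = 0) (ha0 : a ≠ 0) (env : Ctr → ℕ) :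
    ((Prog.set a xs φ).eval N env s).bst = s.bst ∧ ((Prog.set a xs φ).eval N env s).pos = s.pos ∧
    (∀ b ≠ a, b ≠ 19 → ((Prog.set a xs φ).eval N env s).arr b = s.arr b) ∧
    ∀ n < N ^ xs.length, ((Prog.set a xs φ).eval N env s).arr a n =
      φ.val N s.view (point N env xs n) := by
  rw [Prog.set, Prog.eval, eval_fill hφ (h0 _ (by decide)),
    eval_fill (a := a) (by simpa [Fm.arrs] using ha) (by exact h0 _ ha0)]
  refine ⟨rfl, rfl, fun b hb hb' => ?_, fun n hn => ?_⟩
  · simp [hb, hb']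
  · simp only [update_self, if_pos hn]
    rw [Bool.eq_iff_iff, Fm.val_eq_true, Fm.Sat, addr_point _ hxs _ _ hn, Store.view]
    simp [h0, hn]

/-- Only tuples satisfying `φ` have a bit in the input, so the input head moves only on these, and
`g` gives the bit by address. The part `rest` is left for the next program, so that reading programs
can be chained. -/
theorem eval_load {N : ℕ} {a : Arr} {xs : List Ctr} {φ : Fm} {s : Store} (ha : a ∉ φ.arrs)
    (hφ : 0 ∉ φ.arrs) (ha0 : a ≠ 0) (h0 : s.pos a = 0) (env : Ctr → ℕ) (g : ℕ → Bool)
    (rest : List Bool)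
    (hin : ∀ n, s.view 0 n = (((List.range (N ^ xs.length)).flatMap fun m =>
      if φ.val N s.view (point N env xs m) then [g m] else []) ++ rest).getD n false) :
    ∃ p, (Prog.load a xs φ).eval N env s = { s with
        arr := update s.arr a fun n =>
          if n < N ^ xs.length then φ.val N s.view (point N env xs n) && g n else s.arr a n
        pos := update s.pos 0 p } ∧ ∀ n, s.arr 0 (p + n) = rest.getD n false := by
  -- The induction needs arbitrary `rest`: the bit for address `M`, if there is one, belongs to the
  -- rest after `M` rounds.
  have key : ∀ M rest, (∀ n, s.view 0 n = (((List.range M).flatMap fun m =>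
      if φ.val N s.view (point N env xs m) then [g m] else []) ++ rest).getD n false) →
      ∃ p, (List.range M).foldl (fun s m => (Prog.seq φ.comp (.seq (.ite (.seq (.get 0) (.right 0))
        (.const false)) (.seq (.put a) (.right a)))).eval N (point N env xs m) s) s = { s with
        arr := update s.arr a fun n =>
          if n < M then φ.val N s.view (point N env xs n) && g n else s.arr a n
        pos := update (update s.pos a M) 0 p } ∧ ∀ n, s.arr 0 (p + n) = rest.getD n false := by
    intro M
    induction M with
    | zero =>
      refine fun rest h => ⟨s.pos 0, ?_, by simpa [Store.view] using h⟩
      have : update s.pos a 0 = s.pos := by rw [← h0, update_eq_self]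
      simp [this]
    | succ M ih =>
      intro rest hin
      obtain ⟨p, hp, hr⟩ := ih ((if φ.val N s.view (point N env xs M) then [g M] else []) ++ rest)
        (by simpa [List.range_succ] using hin)
      rw [List.range_succ, List.foldl_append, hp]
      simp only [List.foldl_cons, List.foldl_nil, Prog.eval, eval_comp, List.headD_cons,
        List.tail_cons]
      have hv : φ.val N (Store.view { s with
          arr := update s.arr a fun n =>
            if n < M then φ.val N s.view (point N env xs n) && g n else s.arr a n
          pos := update (update s.pos a M) 0 p }) (point N env xs M) =
          φ.val N s.view (point N env xs M) := by
        rw [Bool.eq_iff_iff, Fm.val_eq_true, Fm.val_eq_true]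
        refine φ.sat_congr (fun b hb => ?_) _
        have h₁ : b ≠ a := fun e => ha (e ▸ hb)
        have h₂ : b ≠ 0 := fun e => hφ (e ▸ hb)
        funext n
        simp [Store.view, h₁, h₂]
      simp only [hv]
      have hf : ∀ b : Bool, φ.val N s.view (point N env xs M) = b →
          (update (fun n => if n < M then φ.val N s.view (point N env xs n) && g n else s.arr a n) M
            (b && g M)) =
          fun n => if n < M + 1 then φ.val N s.view (point N env xs n) && g n else s.arr a n := by
        rintro b rfl
        funext n
        rw [update_apply]
        by_cases e : n = M
        · subst e
          simp
        · rw [if_neg e]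
          congr 1
          simp only [eq_iff_iff]
          omega
      cases hb : φ.val N s.view (point N env xs M) with
      | true =>
        rw [hb] at hr
        refine ⟨p + 1, ?_, fun n => by simpa [add_assoc, add_comm 1] using hr (n + 1)⟩
        have hg : s.arr 0 p = g M := by simpa using hr 0
        have := hf true hb
        simp only [Bool.true_and] at this
        simp only [if_true, update_self]
        ext1
        · rfl
        · simp [ha0, ha0.symm, hg, this]
        · funext b
          by_cases e : b = 0
          · subst e; simp [ha0.symm]
          · by_cases e' : b = a
            · subst e'; simp [ha0]
            · simp [e, e']
      | false =>
        rw [hb] at hr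
        refine ⟨p, ?_, fun n => by simpa using hr n⟩
        have := hf false hb
        simp only [Bool.false_and] at this
        simp only [Bool.false_eq_true, if_false]
        ext1
        · rfl
        · simp [ha0, this]
        · funext b
          by_cases e : b = 0
          · subst e; simp [ha0.symm]
          · by_cases e' : b = a
            · subst e'; simp [ha0]
            · simp [e, e']
  obtain ⟨p, hp, hr⟩ := key _ rest hin
  refine ⟨p, ?_, hr⟩
  rw [Prog.load, Prog.eval, eval_nest_left, eval_nest, hp]
  ext1
  · rfl
  · rfl
  · funext b
    by_cases e : b = a
    · subst e; simp [ha0, h0]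
    · by_cases e' : b = 0
      · subst e'; simp [ha0.symm]
      · simp [e, e']

/-- At the closing `false` the input head stops, so the remaining rounds read that bit again and do
nothing. Going left `N ≥ k` times then resets the head of `a`, by truncation. -/
theorem eval_unary {N k : ℕ} {a : Arr} {s : Store} (ha0 : a ≠ 0) (h0 : s.pos a = 0) (hk : k ≤ N)
    (hs : s.arr a = fun _ => false) (env : Ctr → ℕ) (rest : List Bool)
    (hin : ∀ n, s.view 0 n = (List.replicate k true ++ false :: rest).getD n false) :
    ∃ p, (Prog.unary a).eval N env s = { s with
        arr := update s.arr a fun n => decide (n < k)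
        pos := update s.pos 0 p } ∧ ∀ n, s.arr 0 (p + n) = rest.getD n false := by
  have key : ∀ M, (List.range M).foldl (fun s i => (Prog.seq (.get 0)
      (.ite (.seq (.const true) (.seq (.put a) (.seq (.right a) (.right 0)))) .skip)).eval N
        (update env 0 i) s) s = { s with
        arr := update s.arr a fun n => decide (n < min M k)
        pos := update (update s.pos a (min M k)) 0 (s.pos 0 + min M k) } := by
    intro M
    induction M with
    | zero =>
      ext1
      · rfl
      · simp [← hs]
      · have : update s.pos a 0 = s.pos := by rw [← h0, update_eq_self]
        simp [this]
    | succ M ih =>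
      rw [List.range_succ, List.foldl_append, ih]
      simp only [List.foldl_cons, List.foldl_nil, Prog.eval, List.headD_cons,
        List.tail_cons, update_self, update_of_ne ha0.symm, update_of_ne ha0]
      have hb : s.arr 0 (s.pos 0 + min M k) = decide (M < k) := by
        have := hin (min M k)
        rw [Store.view] at this
        rw [this]
        by_cases h : M < k
        · rw [min_eq_left h.le, List.getD_append _ _ _ _ (by simpa using h)]
          simp [h]
        · rw [min_eq_right (not_lt.1 h), List.getD_append_right _ _ _ _ (by simp)]
          simp [h]
      rw [hb]
      by_cases h : M < k
      · rw [if_pos (by simpa using h), min_eq_left h.le, min_eq_left (Nat.succ_le_of_lt h)]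
        ext1
        · rfl
        · simp only [update_idem]
          congr 1
          funext n
          rw [update_apply]
          by_cases e : n = M
          · simp [e]
          · rw [if_neg e, decide_eq_decide]
            omega
        · funext b
          by_cases e : b = 0
          · subst e; simp [add_assoc]
          · by_cases e' : b = a
            · subst e'; simp [ha0]
            · simp [e, e']
      · rw [if_neg (by simpa using h), min_eq_right (not_lt.1 h),
          min_eq_right ((not_lt.1 h).trans (Nat.le_succ M))]
  refine ⟨s.pos 0 + k + 1, ?_, fun n => ?_⟩
  · have hl : ∀ s, (Prog.rep 0 (.left a)).eval N env s =
        { s with pos := update s.pos a (s.pos a - N) } := by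
      intro s
      rw [← iterate_left (N := N) (env := env), ← foldl_range_const]
      rfl
    have hr := key N
    rw [min_eq_right hk] at hr
    rw [Prog.unary, Prog.eval, Prog.eval, hl]
    simp only [Prog.eval] at hr ⊢
    rw [hr]
    ext1
    · rfl
    · rfl
    · funext b
      by_cases e : b = a
      · subst e; simp [ha0, h0, hk]
      · by_cases e' : b = 0
        · subst e'; simp [ha0.symm]
        · simp [e, e']
  · have := hin (k + 1 + n)
    rw [Store.view, List.getD_append_right _ _ _ _ (by simp; omega)] at this
    rw [add_assoc, add_assoc, ← add_assoc k, this]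
    simp [show k + 1 + n - k = n + 1 by omega]

theorem eval_diag {N : ℕ} {a : Arr} {s : Store} (h0 : s.pos a = 0)
    (hs : s.arr a = fun _ => false) (env : Ctr → ℕ) :
    ∃ f : ℕ → Bool, (Prog.diag a).eval N env s = { s with arr := update s.arr a f } ∧
      ∀ i < N, ∀ j < N, f (i * N + j) = true ↔ i = j := by
  have hbody : ∀ i s, s.pos a = 0 → (Prog.seq (.walk (.right a) [0, 0]) (.seq (.const true)
      (.seq (.put a) (.walk (.left a) [0, 0])))).eval N (update env 0 i) s =
      { s with arr := update s.arr a (update (s.arr a) (i * N + i) true) } := by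
    intro i s h0
    simp only [Prog.eval]
    rw [eval_walk (P := .right a) (f := (Prog.right a).eval N env) (fun _ => rfl),
      eval_walk (P := .left a) (f := (Prog.left a).eval N env) (fun _ => rfl), iterate_right,
      iterate_left]
    have : update s.pos a 0 = s.pos := by rw [← h0, update_eq_self]
    simp [addr, h0, this]
  have key : ∀ M, ∃ f : ℕ → Bool, (List.range M).foldl (fun s i => (Prog.seq
      (.walk (.right a) [0, 0]) (.seq (.const true)
      (.seq (.put a) (.walk (.left a) [0, 0])))).eval N (update env 0 i) s) s =
      { s with arr := update s.arr a f } ∧ ∀ n, f n = true ↔ ∃ i < M, n = i * N + i := by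
    intro M
    induction M with
    | zero => exact ⟨fun _ => false, by simp [← hs], by simp⟩
    | succ M ih =>
      obtain ⟨f, hf, h⟩ := ih
      refine ⟨update f (M * N + M) true, ?_, fun n => ?_⟩
      · rw [List.range_succ, List.foldl_append, hf]
        simp only [List.foldl_cons, List.foldl_nil]
        rw [hbody]
        · simp
        · exact h0
      · rw [update_apply, Nat.exists_lt_succ_right, ← h]
        by_cases e : n = M * N + M <;> simp [e]
  obtain ⟨f, hf, h⟩ := key N
  refine ⟨f, hf, fun i hi j hj => ?_⟩
  rw [h]
  constructor
  -- Digits in base `N` are unique: quotient and remainder both return `l`.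
  · rintro ⟨l, hl, e⟩
    have h₁ := congrArg (· / N) e
    have h₂ := congrArg (· % N) e
    simp only [Nat.mul_add_mod_of_lt hj, Nat.mul_add_mod_of_lt hl] at h₂
    simp only [mul_comm _ N, Nat.mul_add_div (show 0 < N by omega), Nat.div_eq_of_lt hj,
      Nat.div_eq_of_lt hl] at h₁
    omega
  · rintro rfl
    exact ⟨i, hi, rfl⟩

end LoopProg

/-! ### Relations in arrays, and reachability within one automaton -/

namespace LoopProg

open Turing Function Relation

/-- The relation of arity 1 stored in an array. -/
def At₁ (f : ℕ → Bool) (i : ℕ) : Prop := f i = true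

/-- The relation of arity 2 on the numbers below `N` stored in an array. -/
def At₂ (N : ℕ) (f : ℕ → Bool) (i j : ℕ) : Prop := f (i * N + j) = true

/-- The relation of arity 3 on the numbers below `N` stored in an array. -/
def At₃ (N : ℕ) (f : ℕ → Bool) (i j l : ℕ) : Prop := f (i * (N * N) + (j * N + l)) = true

section

variable {N : ℕ} {arr : Arr → ℕ → Bool} {env : Ctr → ℕ} {a : Arr} {φ ψ : Fm} {x y z : Ctr}

theorem sat_rel₁ : (Fm.rel a [x]).Sat N arr env ↔ At₁ (arr a) (env x) := by
  simp [Fm.Sat, addr, At₁]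

theorem sat_rel₂ : (Fm.rel a [x, y]).Sat N arr env ↔ At₂ N (arr a) (env x) (env y) := by
  simp [Fm.Sat, addr, At₂]

theorem sat_rel₃ :
    (Fm.rel a [x, y, z]).Sat N arr env ↔ At₃ N (arr a) (env x) (env y) (env z) := by
  simp [Fm.Sat, addr, At₃, sq]

theorem sat_and : (φ.and ψ).Sat N arr env ↔ φ.Sat N arr env ∧ ψ.Sat N arr env := Iff.rfl

theorem sat_or : (φ.or ψ).Sat N arr env ↔ φ.Sat N arr env ∨ ψ.Sat N arr env := Iff.rfl

theorem sat_ex : (Fm.ex x φ).Sat N arr env ↔ ∃ i < N, φ.Sat N arr (update env x i) := Iff.rfl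

end

theorem point₂ {N : ℕ} {env : Ctr → ℕ} {x y : Ctr} {i j : ℕ} (hj : j < N) :
    point N env [x, y] (i * N + j) = update (update env x i) y j := by
  have hN : 0 < N := by omega
  simp only [point, List.length_cons, List.length_nil, zero_add, pow_one, pow_zero, Nat.div_one,
    Nat.mul_add_mod_of_lt hj]
  rw [mul_comm, Nat.mul_add_div hN, Nat.div_eq_of_lt hj, add_zero]

theorem point₃ {N : ℕ} {env : Ctr → ℕ} {x y z : Ctr} {i j l : ℕ} (hj : j < N) (hl : l < N) :
    point N env [x, y, z] (i * (N * N) + (j * N + l)) =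
      update (update (update env x i) y j) z l := by
  have hN : 0 < N * N := Nat.mul_pos (by omega) (by omega)
  have hjl : j * N + l < N * N := by nlinarith
  have : point N env [x, y, z] (i * (N * N) + (j * N + l)) =
      point N (update env x ((i * (N * N) + (j * N + l)) / (N * N))) [y, z]
        ((i * (N * N) + (j * N + l)) % (N * N)) := by
    simp [point, sq]
  rw [this, Nat.mul_add_mod_of_lt hjl, point₂ hl, mul_comm, Nat.mul_add_div hN,
    Nat.div_eq_of_lt hjl, add_zero]

/-- All heads but that of the input are at the beginning. -/
def Store.Clean (s : Store) : Prop := ∀ a ≠ 0, s.pos a = 0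

theorem Store.Clean.sat_iff {N : ℕ} {s : Store} (hs : s.Clean) {φ : Fm} (hφ : 0 ∉ φ.arrs)
    (env : Ctr → ℕ) : φ.Sat N s.view env ↔ φ.Sat N s.arr env := by
  refine φ.sat_congr (fun a ha => ?_) env
  funext n
  rw [Store.view, hs a (fun e => hφ (e ▸ ha)), zero_add]

/-- The store `s'` differs from `s` only in the array `a` and in the scratch array. -/
def Upd (a : Arr) (s s' : Store) : Prop :=
  s'.pos = s.pos ∧ ∀ b ≠ a, b ≠ 19 → s'.arr b = s.arr b

theorem Upd.trans {a : Arr} {s s' s'' : Store} (h : Upd a s s') (h' : Upd a s' s'') :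
    Upd a s s'' :=
  ⟨h'.1.trans h.1, fun b hb hb' => (h'.2 b hb hb').trans (h.2 b hb hb')⟩

theorem Upd.clean {a : Arr} {s s' : Store} (h : Upd a s s') (hs : s.Clean) : s'.Clean :=
  fun b hb => by rw [h.1, hs b hb]

theorem set₂_spec {N : ℕ} {a : Arr} {φ : Fm} {s : Store} (hs : s.Clean) (ha : a ≠ 19)
    (ha0 : a ≠ 0) (hφ : 19 ∉ φ.arrs) (hφ0 : 0 ∉ φ.arrs) (env : Ctr → ℕ) :
    Upd a s ((Prog.set a [0, 1] φ).eval N env s) ∧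
    ∀ i < N, ∀ j < N, (At₂ N (((Prog.set a [0, 1] φ).eval N env s).arr a) i j ↔
      φ.Sat N s.arr (update (update env 0 i) 1 j)) := by
  obtain ⟨-, h₂, h₃, h₄⟩ := eval_set (xs := [0, 1]) (N := N) ha hφ (by decide) hs ha0 env
  refine ⟨⟨h₂, h₃⟩, fun i hi j hj => ?_⟩
  rw [At₂, h₄ _ (show i * N + j < N ^ 2 by nlinarith), point₂ hj,
    Fm.val_eq_true, hs.sat_iff hφ0]

theorem set₃_spec {N : ℕ} {a : Arr} {φ : Fm} {s : Store} (hs : s.Clean) (ha : a ≠ 19)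
    (ha0 : a ≠ 0) (hφ : 19 ∉ φ.arrs) (hφ0 : 0 ∉ φ.arrs) (env : Ctr → ℕ) :
    Upd a s ((Prog.set a [0, 1, 2] φ).eval N env s) ∧
    ∀ i < N, ∀ j < N, ∀ l < N, (At₃ N (((Prog.set a [0, 1, 2] φ).eval N env s).arr a) i j l ↔
      φ.Sat N s.arr (update (update (update env 0 i) 1 j) 2 l)) := by
  obtain ⟨-, h₂, h₃, h₄⟩ := eval_set (xs := [0, 1, 2]) (N := N) ha hφ (by decide) hs ha0 env
  refine ⟨⟨h₂, h₃⟩, fun i hi j hj l hl => ?_⟩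
  have hlt : i * (N * N) + (j * N + l) < N ^ 3 := by
    have h₁ : j * N + l < N * N := by nlinarith
    have h₂ : (i + 1) * (N * N) ≤ N * (N * N) := Nat.mul_le_mul_right _ hi
    have h₃ : N ^ 3 = N * (N * N) := by ring
    rw [h₃]
    linarith [h₂, (by ring : (i + 1) * (N * N) = i * (N * N) + N * N)]
  rw [At₃, h₄ _ hlt, point₃ hj hl, Fm.val_eq_true, hs.sat_iff hφ0]

theorem rep_induction {N : ℕ} {c : Ctr} {P : Prog} {env : Ctr → ℕ} {s : Store}
    (I : ℕ → Store → Prop) (h0 : I 0 s)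
    (hstep : ∀ i < N, ∀ s, I i s → I (i + 1) (P.eval N (update env c i) s)) :
    I N ((Prog.rep c P).eval N env s) := by
  rw [Prog.eval]
  suffices ∀ n ≤ N, I n ((List.range n).foldl (fun s i => P.eval N (update env c i) s) s) from
    this N le_rfl
  intro n
  induction n with
  | zero => exact fun _ => h0
  | succ n ih =>
    intro hn
    rw [List.range_succ, List.foldl_append]
    exact hstep n hn _ (ih (by omega))

/-- The array `f` stores the transitions of `M`. -/
def Stores {k n : ℕ} (N : ℕ) (f : ℕ → Bool) (M : NFA (Fin k) (Fin n)) : Prop :=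
  ∀ i < N, ∀ j < N, ∀ l < N, At₃ N f i j l ↔
    ∃ (hi : i < n) (hj : j < k) (hl : l < n), (⟨l, hl⟩ : Fin n) ∈ M.step ⟨i, hi⟩ ⟨j, hj⟩

/-- For all pairs `q` of states, compute in the array `a` the states that are reachable from the
first or second (if `snd`) component of `q`, or (if not `fwd`) from which that component is
reachable, by the transitions in the array `T` with letters in the set that the array `11` stores
for `q`. -/
def spread (a T : Arr) (fwd snd : Bool) : Prog :=
  .seq (.set a [0, 1, 2] (.rel 10 [if snd then 1 else 0, 2])) <|
    .rep 9 <| .set a [0, 1, 2] <| .or (.rel a [0, 1, 2]) <| .ex 3 <| .ex 4 <|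
      .and (.rel a [0, 1, 3]) <| .and (.rel 11 [0, 1, 4]) <|
        if fwd then .rel T [3, 4, 2] else .rel T [2, 4, 3]

/-- The set of letters stored for a pair of states. -/
def letters (N k : ℕ) (f : ℕ → Bool) (i j : ℕ) : Set (Fin k) := {a | At₃ N f i j a}

/-- The loop computes the stages of `reachIn` from the singleton of the chosen component, set up by
the equality array `10`, along the edges or against them. Its `N` rounds suffice because there are
`n ≤ N` states. -/
theorem spread_spec {N k n : ℕ} {M : NFA (Fin k) (Fin n)} (hk : k ≤ N) (hn : n ≤ N) {s : Store}
    (hs : s.Clean) (heq : ∀ i < N, ∀ j < N, At₂ N (s.arr 10) i j ↔ i = j) {T : Arr}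
    (hT : Stores N (s.arr T) M) {a : Arr} (ha : 11 < a) (ha' : a < 19) (hTa : T < 11)
    (hT0 : T ≠ 0) (fwd snd : Bool) (env : Ctr → ℕ) :
    Upd a s ((spread a T fwd snd).eval N env s) ∧
    ∀ i < N, ∀ j < N, ∀ q : Fin n, q = (if snd then j else i) → ∀ x : Fin n,
      (At₃ N (((spread a T fwd snd).eval N env s).arr a) i j x ↔
        if fwd then ReflTransGen (M.Edge (letters N k (s.arr 11) i j)) q x
        else ReflTransGen (M.Edge (letters N k (s.arr 11) i j)) x q) := by
  have a19 : a ≠ 19 := ha'.ne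
  have a11 : a ≠ 11 := ha.ne'
  have a0 : a ≠ 0 := by rintro rfl; simp at ha
  have aT : T ≠ a := (hTa.trans ha).ne
  have T19 : T ≠ 19 := (hTa.trans (by decide)).ne
  set r : ℕ → ℕ → Fin n → Fin n → Prop := fun i j y x =>
    if fwd then M.Edge (letters N k (s.arr 11) i j) y x
    else M.Edge (letters N k (s.arr 11) i j) x y with hr
  have key := rep_induction (N := N) (c := 9) (env := env)
    (P := .set a [0, 1, 2] <| .or (.rel a [0, 1, 2]) <| .ex 3 <| .ex 4 <|
      .and (.rel a [0, 1, 3]) <| .and (.rel 11 [0, 1, 4]) <|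
        if fwd then .rel T [3, 4, 2] else .rel T [2, 4, 3])
    (s := (Prog.set a [0, 1, 2] (.rel 10 [if snd then 1 else 0, 2])).eval N env s)
    (fun t s' => Upd a s s' ∧ ∀ i < N, ∀ j < N, ∀ q : Fin n, q = (if snd then j else i) →
      ∀ x : Fin n, At₃ N (s'.arr a) i j x ↔ x ∈ reachIn (r i j) {q} t) ?_ ?_
  · refine ⟨key.1, fun i hi j hj q hq x => ?_⟩
    have := key.2 i hi j hj q hq x
    rw [mem_reachIn_iff (by simpa using hn)] at this
    refine this.trans ?_
    simp only [Set.mem_singleton_iff, exists_eq_left, hr]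
    cases fwd
    · simp only [Bool.false_eq_true, if_false]
      exact reflTransGen_swap
    · simp
  · obtain ⟨h₁, h₂⟩ := set₃_spec (N := N) (φ := .rel 10 [if snd then 1 else 0, 2]) hs a19 a0
      (by simp [Fm.arrs]) (by simp [Fm.arrs]) env
    refine ⟨h₁, fun i hi j hj q hq x => ?_⟩
    have hx := x.2.trans_le hn
    rw [h₂ i hi j hj x hx, sat_rel₂, reachIn, Set.mem_singleton_iff, Fin.ext_iff, hq]
    cases snd
    · have : update (update (update env 0 i) 1 j) 2 (x : ℕ) 0 = i := by simp
      simp [heq i hi x hx, eq_comm]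
    · simp [heq j hj x hx, eq_comm]
  · rintro t ht s' ⟨hu, h⟩
    obtain ⟨h₁, h₂⟩ := set₃_spec (N := N) (s := s') (a := a)
      (φ := .or (.rel a [0, 1, 2]) <| .ex 3 <| .ex 4 <|
        .and (.rel a [0, 1, 3]) <| .and (.rel 11 [0, 1, 4]) <|
          if fwd then .rel T [3, 4, 2] else .rel T [2, 4, 3]) (hu.clean hs) a19 a0
      (by cases fwd <;> simp [Fm.arrs, a19.symm, T19.symm])
      (by cases fwd <;> simp [Fm.arrs, a0.symm, hT0.symm]) (update env 9 t)
    refine ⟨hu.trans h₁, fun i hi j hj q hq x => ?_⟩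
    have hx := x.2.trans_le hn
    rw [h₂ i hi j hj x hx, sat_or, sat_rel₃]
    have e11 : s'.arr 11 = s.arr 11 := hu.2 _ a11.symm (by decide)
    have eT : s'.arr T = s.arr T := hu.2 _ aT T19
    change _ ↔ x ∈ reachIn (r i j) {q} t ∨ ∃ y ∈ reachIn (r i j) {q} t, r i j y x
    refine or_congr (by simpa using h i hi j hj q hq x) ?_
    simp only [sat_ex, sat_and, sat_rel₃]
    constructor
    -- The quantifiers range over all numbers below `N`; the transition array guarantees that `y` is
    -- a state and `b` a letter.
    · rintro ⟨y, hy, b, hb, h₃, h₄, h₅⟩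
      cases fwd
      · simp only [Bool.false_eq_true, if_false, sat_rel₃] at h₅
        simp [e11, eT] at h₃ h₄ h₅
        obtain ⟨_, hb', hy', h₆⟩ := (hT _ hx _ hb _ hy).1 h₅
        exact ⟨⟨y, hy'⟩, (h i hi j hj q hq ⟨y, hy'⟩).1 h₃, ⟨b, hb'⟩, h₄, h₆⟩
      · simp only [if_true, sat_rel₃] at h₅
        simp [e11, eT] at h₃ h₄ h₅
        obtain ⟨hy', hb', _, h₆⟩ := (hT _ hy _ hb _ hx).1 h₅
        exact ⟨⟨y, hy'⟩, (h i hi j hj q hq ⟨y, hy'⟩).1 h₃, ⟨b, hb'⟩, h₄, h₆⟩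
    · rintro ⟨y, h₃, h₄⟩
      have hy := y.2.trans_le hn
      cases fwd
      · obtain ⟨b, h₄, h₅⟩ := h₄
        have hb := b.2.trans_le hk
        refine ⟨y, hy, b, hb, ?_⟩
        simp only [Bool.false_eq_true, if_false, sat_rel₃]
        simp [e11, eT]
        exact ⟨(h i hi j hj q hq y).2 h₃, h₄, (hT _ hx _ hb _ hy).2 ⟨x.2, b.2, y.2, h₅⟩⟩
      · obtain ⟨b, h₄, h₅⟩ := h₄
        have hb := b.2.trans_le hk
        refine ⟨y, hy, b, hb, ?_⟩
        simp only [if_true, sat_rel₃]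
        simp [e11, eT]
        exact ⟨(h i hi j hj q hq y).2 h₃, h₄, (hT _ hy _ hb _ hx).2 ⟨y.2, b.2, x.2, h₅⟩⟩

end LoopProg

/-! ### Computing the largest sets of loop letters -/

namespace LoopProg

open Turing Function Relation

/-- The arrays `1` to `10` store the sets of letters and of states, the initial states, the final
states and the transitions of two automata, and the equality relation. -/
structure Loaded {k n₁ n₂ : ℕ} (N : ℕ) (M₁ : NFA (Fin k) (Fin n₁)) (M₂ : NFA (Fin k) (Fin n₂))
    (s : Store) : Prop where
  clean : s.Clean
  letter : ∀ i < N, At₁ (s.arr 1) i ↔ i < k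
  state₁ : ∀ i < N, At₁ (s.arr 2) i ↔ i < n₁
  state₂ : ∀ i < N, At₁ (s.arr 3) i ↔ i < n₂
  start₁ : ∀ i < N, At₁ (s.arr 4) i ↔ ∃ h : i < n₁, (⟨i, h⟩ : Fin n₁) ∈ M₁.start
  start₂ : ∀ i < N, At₁ (s.arr 5) i ↔ ∃ h : i < n₂, (⟨i, h⟩ : Fin n₂) ∈ M₂.start
  accept₁ : ∀ i < N, At₁ (s.arr 6) i ↔ ∃ h : i < n₁, (⟨i, h⟩ : Fin n₁) ∈ M₁.accept
  accept₂ : ∀ i < N, At₁ (s.arr 7) i ↔ ∃ h : i < n₂, (⟨i, h⟩ : Fin n₂) ∈ M₂.accept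
  step₁ : Stores N (s.arr 8) M₁
  step₂ : Stores N (s.arr 9) M₂
  eq : ∀ i < N, ∀ j < N, At₂ N (s.arr 10) i j ↔ i = j

/-- The arrays `12` to `15` store the states reachable from and to the components of a pair of
states, with letters from the set stored in the array `11`. -/
structure Closed {k n₁ n₂ : ℕ} (N : ℕ) (M₁ : NFA (Fin k) (Fin n₁)) (M₂ : NFA (Fin k) (Fin n₂))
    (s : Store) : Prop where
  from₁ : ∀ (q : Fin n₁ × Fin n₂) (x : Fin n₁), At₃ N (s.arr 12) q.1 q.2 x ↔
    ReflTransGen (M₁.Edge (letters N k (s.arr 11) q.1 q.2)) q.1 x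
  from₂ : ∀ (q : Fin n₁ × Fin n₂) (x : Fin n₂), At₃ N (s.arr 13) q.1 q.2 x ↔
    ReflTransGen (M₂.Edge (letters N k (s.arr 11) q.1 q.2)) q.2 x
  to₁ : ∀ (q : Fin n₁ × Fin n₂) (x : Fin n₁), At₃ N (s.arr 14) q.1 q.2 x ↔
    ReflTransGen (M₁.Edge (letters N k (s.arr 11) q.1 q.2)) x q.1
  to₂ : ∀ (q : Fin n₁ × Fin n₂) (x : Fin n₂), At₃ N (s.arr 15) q.1 q.2 x ↔
    ReflTransGen (M₂.Edge (letters N k (s.arr 11) q.1 q.2)) x q.2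

/-- Compute the arrays `12` to `15`. -/
def closure : Prog :=
  .seq (spread 12 8 true false) <| .seq (spread 13 9 true true) <|
    .seq (spread 14 8 false false) (spread 15 9 false true)

/-- Remove letters that occur in no loops from the sets in the array `11`. -/
def prune : Prog :=
  .set 11 [0, 1, 2] <| .and (.rel 11 [0, 1, 2]) <| .and
    (.ex 3 <| .ex 4 <| .and (.rel 12 [0, 1, 3]) <| .and (.rel 8 [3, 2, 4]) (.rel 14 [0, 1, 4]))
    (.ex 3 <| .ex 4 <| .and (.rel 13 [0, 1, 3]) <| .and (.rel 9 [3, 2, 4]) (.rel 15 [0, 1, 4]))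

/-- Compute the largest sets of letters of common loops, and their closures. -/
def loops : Prog :=
  .seq (.set 11 [0, 1, 2] <| .and (.rel 2 [0]) <| .and (.rel 3 [1]) (.rel 1 [2])) <|
    .seq (.rep 8 (.seq closure prune)) closure

/-- Add the successors of the pairs of states in the array `16`. -/
def advance : Prog :=
  .set 16 [0, 1] <| .or (.rel 16 [0, 1]) <| .or
    (.ex 2 <| .ex 3 <| .ex 4 <| .and (.rel 16 [2, 3]) <| .and (.rel 8 [2, 4, 0]) (.rel 9 [3, 4, 1]))
    (.ex 2 <| .ex 3 <| .and (.rel 16 [2, 3]) <| .and (.rel 2 [2]) <| .and (.rel 3 [3]) <|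
      .ex 4 <| .ex 5 <| .and (.ex 6 (.rel 11 [4, 5, 6])) <|
        .and (.rel 14 [4, 5, 2]) <| .and (.rel 15 [4, 5, 3]) <|
          .and (.rel 12 [4, 5, 0]) (.rel 13 [4, 5, 1]))

/-- Compute the reachable pairs of states. -/
def explore : Prog :=
  .seq (.set 16 [0, 1] (.and (.rel 4 [0]) (.rel 5 [1]))) (.rep 8 (.rep 9 advance))

/-- Push the answer. -/
def answer : Prog :=
  (Fm.ex 0 <| .ex 1 <| .and (.rel 16 [0, 1]) <| .and (.rel 6 [0]) (.rel 7 [1])).comp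

variable {k n₁ n₂ N : ℕ} {M₁ : NFA (Fin k) (Fin n₁)} {M₂ : NFA (Fin k) (Fin n₂)}

theorem Loaded.of_upd {s s' : Store} (h : Loaded N M₁ M₂ s) {a : Arr} (ha : 10 < a)
    (hu : Upd a s s') : Loaded N M₁ M₂ s' := by
  have e : ∀ b ≤ 10, s'.arr b = s.arr b := fun b hb =>
    hu.2 b (hb.trans_lt ha).ne (hb.trans_lt (by decide)).ne
  exact ⟨hu.clean h.clean, by rw [e 1 (by decide)]; exact h.letter,
    by rw [e 2 (by decide)]; exact h.state₁, by rw [e 3 (by decide)]; exact h.state₂,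
    by rw [e 4 (by decide)]; exact h.start₁, by rw [e 5 (by decide)]; exact h.start₂,
    by rw [e 6 (by decide)]; exact h.accept₁, by rw [e 7 (by decide)]; exact h.accept₂,
    by rw [e 8 (by decide)]; exact h.step₁, by rw [e 9 (by decide)]; exact h.step₂,
    by rw [e 10 (by decide)]; exact h.eq⟩

theorem closure_spec (hk : k ≤ N) (h₁ : n₁ ≤ N) (h₂ : n₂ ≤ N) {s : Store}
    (hs : Loaded N M₁ M₂ s) (env : Ctr → ℕ) :
    Loaded N M₁ M₂ (closure.eval N env s) ∧ Closed N M₁ M₂ (closure.eval N env s) ∧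
      (closure.eval N env s).arr 11 = s.arr 11 := by
  rw [closure, Prog.eval, Prog.eval, Prog.eval]
  obtain ⟨u₁, e₁⟩ := spread_spec hk h₁ hs.clean hs.eq hs.step₁ (a := 12) (by decide) (by decide)
    (by decide) (by decide) true false env
  have hs₁ := hs.of_upd (by decide) u₁
  generalize (spread 12 8 true false).eval N env s = s₁ at *
  obtain ⟨u₂, e₂⟩ := spread_spec hk h₂ hs₁.clean hs₁.eq hs₁.step₂ (a := 13) (by decide) (by decide)
    (by decide) (by decide) true true env
  have hs₂ := hs₁.of_upd (by decide) u₂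
  generalize (spread 13 9 true true).eval N env s₁ = s₂ at *
  obtain ⟨u₃, e₃⟩ := spread_spec hk h₁ hs₂.clean hs₂.eq hs₂.step₁ (a := 14) (by decide) (by decide)
    (by decide) (by decide) false false env
  have hs₃ := hs₂.of_upd (by decide) u₃
  generalize (spread 14 8 false false).eval N env s₂ = s₃ at *
  obtain ⟨u₄, e₄⟩ := spread_spec hk h₂ hs₃.clean hs₃.eq hs₃.step₂ (a := 15) (by decide) (by decide)
    (by decide) (by decide) false true env
  have hs₄ := hs₃.of_upd (by decide) u₄
  generalize (spread 15 9 false true).eval N env s₃ = s₄ at *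
  have b₁ : s₁.arr 11 = s.arr 11 := u₁.2 _ (by decide) (by decide)
  have b₂ : s₂.arr 11 = s₁.arr 11 := u₂.2 _ (by decide) (by decide)
  have b₃ : s₃.arr 11 = s₂.arr 11 := u₃.2 _ (by decide) (by decide)
  have b₄ : s₄.arr 11 = s₃.arr 11 := u₄.2 _ (by decide) (by decide)
  refine ⟨hs₄, ⟨fun q x => ?_, fun q x => ?_, fun q x => ?_, fun q x => ?_⟩, ?_⟩
  · rw [u₄.2 _ (by decide) (by decide), u₃.2 _ (by decide) (by decide),
      u₂.2 _ (by decide) (by decide), b₄, b₃, b₂, b₁]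
    exact e₁ _ (q.1.2.trans_le h₁) _ (q.2.2.trans_le h₂) q.1 rfl x
  · rw [u₄.2 _ (by decide) (by decide), u₃.2 _ (by decide) (by decide), b₄, b₃, b₂]
    exact e₂ _ (q.1.2.trans_le h₁) _ (q.2.2.trans_le h₂) q.2 rfl x
  · rw [u₄.2 _ (by decide) (by decide), b₄, b₃]
    exact e₃ _ (q.1.2.trans_le h₁) _ (q.2.2.trans_le h₂) q.1 rfl x
  · rw [b₄]
    exact e₄ _ (q.1.2.trans_le h₁) _ (q.2.2.trans_le h₂) q.2 rfl x
  · rw [b₄, b₃, b₂, b₁]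

/-- The array `11` stores the given sets of letters, for all pairs of states. -/
def Letters (N : ℕ) (G : Fin n₁ × Fin n₂ → Set (Fin k)) (s : Store) : Prop :=
  (∀ i < N, ∀ j < N, ∀ l < N, At₃ N (s.arr 11) i j l → i < n₁ ∧ j < n₂ ∧ l < k) ∧
    ∀ q, letters N k (s.arr 11) q.1 q.2 = G q

/-- With the closures for the present sets at hand, `LoopVia` is first-order: there is a transition
by the letter from a state reachable from `q` to one that reaches `q`. -/
theorem prune_spec (hk : k ≤ N) (h₁ : n₁ ≤ N) (h₂ : n₂ ≤ N) {s : Store}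
    (hs : Loaded N M₁ M₂ s) (hc : Closed N M₁ M₂ s) {G : Fin n₁ × Fin n₂ → Set (Fin k)}
    (hG : Letters N G s) (env : Ctr → ℕ) :
    Loaded N M₁ M₂ (prune.eval N env s) ∧
      Letters N (fun q => {a | a ∈ G q ∧ NFA.CommonLoopVia M₁ M₂ q (G q) a})
        (prune.eval N env s) := by
  obtain ⟨u, h⟩ := set₃_spec (N := N) hs.clean (a := 11) (φ := .and (.rel 11 [0, 1, 2]) <| .and
    (.ex 3 <| .ex 4 <| .and (.rel 12 [0, 1, 3]) <| .and (.rel 8 [3, 2, 4]) (.rel 14 [0, 1, 4]))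
    (.ex 3 <| .ex 4 <| .and (.rel 13 [0, 1, 3]) <| .and (.rel 9 [3, 2, 4]) (.rel 15 [0, 1, 4])))
    (by decide) (by decide) (by decide) (by decide) env
  refine ⟨hs.of_upd (by decide) u, fun i hi j hj l hl hat => ?_, fun q => ?_⟩
  · have := ((h i hi j hj l hl).1 hat).1
    rw [sat_rel₃] at this
    simp at this
    exact hG.1 i hi j hj l hl this
  · ext a
    refine (h _ (q.1.2.trans_le h₁) _ (q.2.2.trans_le h₂) _ (a.2.trans_le hk)).trans ?_
    simp only [sat_and, sat_ex, sat_rel₃]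
    refine and_congr ?_ (and_congr ?_ ?_)
    · rw [← hG.2 q]
      simp [letters]
    · simp
      constructor
      · rintro ⟨x, hx, y, hy, h₃, h₄, h₅⟩
        obtain ⟨hx', _, hy', h₄⟩ := (hs.step₁ x hx _ (a.2.trans_le hk) y hy).1 h₄
        have h₃ := (hc.from₁ q ⟨x, hx'⟩).1 h₃
        have h₅ := (hc.to₁ q ⟨y, hy'⟩).1 h₅
        rw [hG.2] at h₃ h₅
        exact ⟨⟨x, hx'⟩, ⟨y, hy'⟩, h₃, h₄, h₅⟩
      · rintro ⟨x, y, h₃, h₄, h₅⟩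
        rw [← hG.2] at h₃ h₅
        exact ⟨x, x.2.trans_le h₁, y, y.2.trans_le h₁, (hc.from₁ q x).2 h₃,
          (hs.step₁ _ (x.2.trans_le h₁) _ (a.2.trans_le hk) _ (y.2.trans_le h₁)).2
            ⟨x.2, a.2, y.2, h₄⟩, (hc.to₁ q y).2 h₅⟩
    · simp
      constructor
      · rintro ⟨x, hx, y, hy, h₃, h₄, h₅⟩
        obtain ⟨hx', _, hy', h₄⟩ := (hs.step₂ x hx _ (a.2.trans_le hk) y hy).1 h₄
        have h₃ := (hc.from₂ q ⟨x, hx'⟩).1 h₃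
        have h₅ := (hc.to₂ q ⟨y, hy'⟩).1 h₅
        rw [hG.2] at h₃ h₅
        exact ⟨⟨x, hx'⟩, ⟨y, hy'⟩, h₃, h₄, h₅⟩
      · rintro ⟨x, y, h₃, h₄, h₅⟩
        rw [← hG.2] at h₃ h₅
        exact ⟨x, x.2.trans_le h₂, y, y.2.trans_le h₂, (hc.from₂ q x).2 h₃,
          (hs.step₂ _ (x.2.trans_le h₂) _ (a.2.trans_le hk) _ (y.2.trans_le h₂)).2
            ⟨x.2, a.2, y.2, h₄⟩, (hc.to₂ q y).2 h₅⟩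

/-- The initial sets contain all letters, and `N ≥ k` rounds reach the largest solution. A round of
pruning may change array `11` without updating the closures, so they are computed once more at the
end. -/
theorem loops_spec (hk : k ≤ N) (h₁ : n₁ ≤ N) (h₂ : n₂ ≤ N) {s : Store}
    (hs : Loaded N M₁ M₂ s) (env : Ctr → ℕ) :
    Loaded N M₁ M₂ (loops.eval N env s) ∧ Closed N M₁ M₂ (loops.eval N env s) ∧
      Letters N (fun q => pruneIn (NFA.CommonLoopVia M₁ M₂ q) N) (loops.eval N env s) := by
  obtain ⟨u, h⟩ := set₃_spec (N := N) hs.clean (a := 11)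
    (φ := .and (.rel 2 [0]) <| .and (.rel 3 [1]) (.rel 1 [2]))
    (by decide) (by decide) (by decide) (by decide) env
  simp only [loops, Prog.eval.eq_8]
  have hs₁ := hs.of_upd (by decide) u
  set s₁ := (Prog.set 11 [0, 1, 2]
    (.and (.rel 2 [0]) <| .and (.rel 3 [1]) (.rel 1 [2]))).eval N env s
  have h' : ∀ i < N, ∀ j < N, ∀ l < N, At₃ N (s₁.arr 11) i j l ↔ i < n₁ ∧ j < n₂ ∧ l < k := by
    intro i hi j hj l hl
    rw [h i hi j hj l hl]
    simp only [sat_and, sat_rel₁]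
    simp [hs.letter l hl, hs.state₁ i hi, hs.state₂ j hj]
  obtain ⟨hs₂, hl₂⟩ := rep_induction (N := N) (c := 8) (env := env) (P := .seq closure prune)
    (s := s₁) (fun t s => Loaded N M₁ M₂ s ∧
      Letters N (fun q => pruneIn (NFA.CommonLoopVia M₁ M₂ q) t) s)
    ⟨hs₁, fun i hi j hj l hl => (h' i hi j hj l hl).1, fun q => Set.eq_univ_of_forall fun a =>
      (h' _ (q.1.2.trans_le h₁) _ (q.2.2.trans_le h₂) _ (a.2.trans_le hk)).2
        ⟨q.1.2, q.2.2, a.2⟩⟩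
    (by
      rintro t - s ⟨hs, hl⟩
      obtain ⟨c₁, c₂, c₃⟩ := closure_spec hk h₁ h₂ hs (update env 8 t)
      rw [Prog.eval]
      exact prune_spec hk h₁ h₂ c₁ c₂ (by rw [Letters, c₃]; exact hl) _)
  obtain ⟨c₁, c₂, c₃⟩ := closure_spec hk h₁ h₂ hs₂ env
  refine ⟨c₁, c₂, ?_⟩
  rw [Letters, c₃]
  exact hl₂

end LoopProg

/-! ### Exploring the product graph -/

namespace LoopProg

open Turing Function Relation

variable {k n₁ n₂ N : ℕ} {M₁ : NFA (Fin k) (Fin n₁)} {M₂ : NFA (Fin k) (Fin n₂)}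

/-- The array `16` stores the given set of pairs of states. -/
def Pairs (N : ℕ) (V : Set (Fin n₁ × Fin n₂)) (s : Store) : Prop :=
  ∀ x : Fin n₁ × Fin n₂, At₂ N (s.arr 16) x.1 x.2 ↔ x ∈ V

theorem Closed.of_upd {s s' : Store} (h : Closed N M₁ M₂ s) (hu : Upd 16 s s') :
    Closed N M₁ M₂ s' := by
  have e : ∀ b < 16, s'.arr b = s.arr b := fun b hb =>
    hu.2 b hb.ne (hb.trans (by decide)).ne
  exact ⟨by rw [e 12 (by decide), e 11 (by decide)]; exact h.from₁,
    by rw [e 13 (by decide), e 11 (by decide)]; exact h.from₂,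
    by rw [e 14 (by decide), e 11 (by decide)]; exact h.to₁,
    by rw [e 15 (by decide), e 11 (by decide)]; exact h.to₂⟩

theorem Letters.of_upd {s s' : Store} {G : Fin n₁ × Fin n₂ → Set (Fin k)} (h : Letters N G s)
    (hu : Upd 16 s s') : Letters N G s' := by
  rw [Letters, hu.2 11 (by decide) (by decide)]
  exact h

/-- `Pairs` says nothing about indices that are not states, so the formula must exclude them. For a
letter step the transitions do so. For a loop step the arrays `2` and `3` restrict the source, and
nonemptiness of the letter set restricts `q`, since array `11` has no entries outside the proper
ranges. -/
theorem advance_spec (hk : k ≤ N) (h₁ : n₁ ≤ N) (h₂ : n₂ ≤ N) {s : Store}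
    (hs : Loaded N M₁ M₂ s) (hc : Closed N M₁ M₂ s) {G : Fin n₁ × Fin n₂ → Set (Fin k)}
    (hG : Letters N G s) {V : Set (Fin n₁ × Fin n₂)} (hV : Pairs N V s) (env : Ctr → ℕ) :
    Upd 16 s (advance.eval N env s) ∧
      Pairs N {x | x ∈ V ∨ ∃ y ∈ V, NFA.CommonStep M₁ M₂ G y x} (advance.eval N env s) := by
  obtain ⟨u, h⟩ := set₂_spec (N := N) hs.clean (a := 16) (φ := .or (.rel 16 [0, 1]) <| .or
    (.ex 2 <| .ex 3 <| .ex 4 <| .and (.rel 16 [2, 3]) <| .and (.rel 8 [2, 4, 0]) (.rel 9 [3, 4, 1]))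
    (.ex 2 <| .ex 3 <| .and (.rel 16 [2, 3]) <| .and (.rel 2 [2]) <| .and (.rel 3 [3]) <|
      .ex 4 <| .ex 5 <| .and (.ex 6 (.rel 11 [4, 5, 6])) <|
        .and (.rel 14 [4, 5, 2]) <| .and (.rel 15 [4, 5, 3]) <|
          .and (.rel 12 [4, 5, 0]) (.rel 13 [4, 5, 1])))
    (by decide) (by decide) (by decide) (by decide) env
  refine ⟨u, fun x => ?_⟩
  have l₁ : ∀ x : Fin n₁, (x : ℕ) < N := fun x => x.2.trans_le h₁
  have l₂ : ∀ x : Fin n₂, (x : ℕ) < N := fun x => x.2.trans_le h₂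
  have lk : ∀ x : Fin k, (x : ℕ) < N := fun x => x.2.trans_le hk
  refine (h _ (l₁ x.1) _ (l₂ x.2)).trans ?_
  simp only [sat_or, sat_and, sat_ex, sat_rel₃, sat_rel₂, sat_rel₁]
  simp only [ne_eq, Fin.reduceEq, not_false_eq_true, update_of_ne, update_self]
  rw [Set.mem_ofPred_eq]
  refine or_congr ?_ ?_
  · simpa using hV x
  constructor
  · rintro (⟨y₁, hy₁, y₂, hy₂, a, ha, h₃, h₄, h₅⟩ |
      ⟨y₁, hy₁, y₂, hy₂, h₃, h₄, h₅, q₁, hq₁, q₂, hq₂, ⟨a, ha, h₆⟩, h₇, h₈, h₉, h₁₀⟩)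
    · obtain ⟨hy₁', ha', _, h₄⟩ := (hs.step₁ _ hy₁ _ ha _ (l₁ x.1)).1 (by simpa using h₄)
      obtain ⟨hy₂', _, _, h₅⟩ := (hs.step₂ _ hy₂ _ ha _ (l₂ x.2)).1 (by simpa using h₅)
      exact ⟨(⟨y₁, hy₁'⟩, ⟨y₂, hy₂'⟩), (hV _).1 h₃, .inl ⟨⟨a, ha'⟩, h₄, h₅⟩⟩
    · have hy₁' := (hs.state₁ _ hy₁).1 h₄
      have hy₂' := (hs.state₂ _ hy₂).1 h₅
      obtain ⟨hq₁', hq₂', ha'⟩ := hG.1 _ hq₁ _ hq₂ _ ha h₆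
      have e := hG.2 (⟨q₁, hq₁'⟩, ⟨q₂, hq₂'⟩)
      have h₇ := (hc.to₁ (⟨q₁, hq₁'⟩, ⟨q₂, hq₂'⟩) ⟨y₁, hy₁'⟩).1 h₇
      have h₈ := (hc.to₂ (⟨q₁, hq₁'⟩, ⟨q₂, hq₂'⟩) ⟨y₂, hy₂'⟩).1 h₈
      have h₉ := (hc.from₁ (⟨q₁, hq₁'⟩, ⟨q₂, hq₂'⟩) x.1).1 (by simpa using h₉)
      have h₁₀ := (hc.from₂ (⟨q₁, hq₁'⟩, ⟨q₂, hq₂'⟩) x.2).1 (by simpa using h₁₀)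
      rw [e] at h₇ h₈ h₉ h₁₀
      refine ⟨(⟨y₁, hy₁'⟩, ⟨y₂, hy₂'⟩), (hV _).1 h₃, .inr ⟨(⟨q₁, hq₁'⟩, ⟨q₂, hq₂'⟩), ?_,
        h₇, h₈, h₉, h₁₀⟩⟩
      rw [← e]
      exact ⟨⟨a, ha'⟩, h₆⟩
  · rintro ⟨y, hy, ⟨a, h₄, h₅⟩ | ⟨q, ⟨a, h₆⟩, h₇, h₈, h₉, h₁₀⟩⟩
    · left
      refine ⟨y.1, l₁ _, y.2, l₂ _, a, lk _, (hV y).2 hy, ?_, ?_⟩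
      · have := (hs.step₁ _ (l₁ y.1) _ (lk a) _ (l₁ x.1)).2 ⟨y.1.2, a.2, x.1.2, h₄⟩
        simpa using this
      · have := (hs.step₂ _ (l₂ y.2) _ (lk a) _ (l₂ x.2)).2 ⟨y.2.2, a.2, x.2.2, h₅⟩
        simpa using this
    · right
      rw [← hG.2] at h₆ h₇ h₈ h₉ h₁₀
      refine ⟨y.1, l₁ _, y.2, l₂ _, (hV y).2 hy, (hs.state₁ _ (l₁ _)).2 y.1.2,
        (hs.state₂ _ (l₂ _)).2 y.2.2, q.1, l₁ _, q.2, l₂ _, ⟨a, lk a, h₆⟩, (hc.to₁ q y.1).2 h₇,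
        (hc.to₂ q y.2).2 h₈, ?_, ?_⟩
      · simpa using (hc.from₁ q x.1).2 h₉
      · simpa using (hc.from₂ q x.2).2 h₁₀

theorem explore_spec (hk : k ≤ N) (h₁ : n₁ ≤ N) (h₂ : n₂ ≤ N) {s : Store}
    (hs : Loaded N M₁ M₂ s) (hc : Closed N M₁ M₂ s) {G : Fin n₁ × Fin n₂ → Set (Fin k)}
    (hG : Letters N G s) (env : Ctr → ℕ) :
    Loaded N M₁ M₂ (explore.eval N env s) ∧
      Pairs N {y | ∃ x : Fin n₁ × Fin n₂, (x.1 ∈ M₁.start ∧ x.2 ∈ M₂.start) ∧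
        ReflTransGen (NFA.CommonStep M₁ M₂ G) x y} (explore.eval N env s) := by
  obtain ⟨u, h⟩ := set₂_spec (N := N) hs.clean (a := 16) (φ := .and (.rel 4 [0]) (.rel 5 [1]))
    (by decide) (by decide) (by decide) (by decide) env
  rw [explore, Prog.eval]
  generalize (Prog.set 16 [0, 1] (.and (.rel 4 [0]) (.rel 5 [1]))).eval N env s = s₁ at *
  set S : Set (Fin n₁ × Fin n₂) := {x | x.1 ∈ M₁.start ∧ x.2 ∈ M₂.start} with hS
  set r := NFA.CommonStep M₁ M₂ G
  have h0 : Pairs N (reachIn r S 0) s₁ := by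
    intro x
    rw [h _ (x.1.2.trans_le h₁) _ (x.2.2.trans_le h₂), sat_and, sat_rel₁, sat_rel₁]
    simp [hs.start₁ _ (x.1.2.trans_le h₁), hs.start₂ _ (x.2.2.trans_le h₂), reachIn, S]
  -- Two nested loops give `N * N` rounds, enough for the `n₁ * n₂` pairs of states.
  obtain ⟨hu, hV⟩ := rep_induction (N := N) (c := 8) (env := env) (P := .rep 9 advance) (s := s₁)
    (fun t s' => Upd 16 s s' ∧ Pairs N (reachIn r S (t * N)) s') ⟨u, by simpa using h0⟩ (by
      rintro t - s' h
      have := rep_induction (N := N) (c := 9) (env := update env 8 t) (P := advance) (s := s')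
        (fun t' s' => Upd 16 s s' ∧ Pairs N (reachIn r S (t * N + t')) s') h (by
          rintro t' - s' ⟨hu, hV⟩
          obtain ⟨a₁, a₂⟩ := advance_spec hk h₁ h₂ (hs.of_upd (by decide) hu) (hc.of_upd hu)
            (hG.of_upd hu) hV (update (update env 8 t) 9 t')
          exact ⟨hu.trans a₁, a₂⟩)
      rwa [Nat.succ_mul])
  refine ⟨hs.of_upd (by decide) hu, fun x => (hV x).trans ?_⟩
  rw [mem_reachIn_iff (by simpa using Nat.mul_le_mul h₁ h₂)]
  rfl

/-- The part of the algorithm that follows the reading of the input. -/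
def decideProg : Prog := .seq loops <| .seq explore answer

theorem decideProg_spec (hk : k ≤ N) (h₁ : n₁ ≤ N) (h₂ : n₂ ≤ N) {s : Store}
    (hs : Loaded N M₁ M₂ s) (env : Ctr → ℕ) :
    (decideProg.eval N env s).bst.headD false = hasCommonPatternPath M₁ M₂ := by
  rw [decideProg, Prog.eval, Prog.eval]
  obtain ⟨a₁, a₂, a₃⟩ := loops_spec hk h₁ h₂ hs env
  generalize loops.eval N env s = s₁ at *
  obtain ⟨b₁, b₂⟩ := explore_spec hk h₁ h₂ a₁ a₂ a₃ env
  generalize explore.eval N env s₁ = s₂ at *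
  rw [answer, eval_comp, List.headD_cons, Bool.eq_iff_iff, Fm.val_eq_true,
    b₁.clean.sat_iff (by decide), show hasCommonPatternPath M₁ M₂ = true ↔ ∃ P,
      M₁.AdmitsPath P ∧ M₂.AdmitsPath P by simp [hasCommonPatternPath],
    NFA.exists_common_pattern_iff (m := N) (by simpa using hk)]
  simp only [sat_and, sat_ex, sat_rel₂, sat_rel₁]
  simp only [ne_eq, Fin.reduceEq, not_false_eq_true, update_of_ne, update_self]
  constructor
  · rintro ⟨y₁, hy₁, y₂, hy₂, h₃, h₄, h₅⟩
    obtain ⟨hy₁', h₄⟩ := (b₁.accept₁ _ hy₁).1 (by simpa using h₄)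
    obtain ⟨hy₂', h₅⟩ := (b₁.accept₂ _ hy₂).1 h₅
    obtain ⟨x, hx, h⟩ := (b₂ (⟨y₁, hy₁'⟩, ⟨y₂, hy₂'⟩)).1 (by simpa using h₃)
    exact ⟨x, _, hx, ⟨h₄, h₅⟩, h⟩
  · rintro ⟨x, y, hx, ⟨h₄, h₅⟩, h⟩
    refine ⟨y.1, y.1.2.trans_le h₁, y.2, y.2.2.trans_le h₂, ?_, ?_,
      (b₁.accept₂ _ (y.2.2.trans_le h₂)).2 ⟨y.2.2, h₅⟩⟩
    · simpa using (b₂ y).2 ⟨x, hx, h⟩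
    · simpa using (b₁.accept₁ _ (y.1.2.trans_le h₁)).2 ⟨y.1.2, h₄⟩

end LoopProg

/-! ### Reading the input, and the final time bound -/

namespace LoopProg

open Turing Function Relation

/-- The input lists bits by proper states and letters, while arrays are indexed by all numbers below
`N`; the surplus indices contribute no bits. -/
theorem flatMap_range_eq {α : Type*} {n N : ℕ} (hn : n ≤ N) {f : ℕ → List α} {g : Fin n → List α}
    (h : ∀ i : Fin n, f i = g i) (h' : ∀ i < N, n ≤ i → f i = []) :
    (List.range N).flatMap f = (List.finRange n).flatMap g := by
  obtain ⟨d, rfl⟩ := Nat.exists_eq_add_of_le hn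
  have e₂ : (List.map (n + ·) (List.range d)).flatMap f = [] := by
    rw [List.flatMap_eq_nil_iff]
    intro i hi
    simp only [List.mem_map, List.mem_range] at hi
    obtain ⟨j, hj, rfl⟩ := hi
    exact h' _ (by omega) (by omega)
  rw [List.range_add, List.flatMap_append, e₂, List.append_nil, ← List.map_coe_finRange_eq_range,
    List.flatMap_map]
  exact congrArg (List.flatMap · _) (funext h)

theorem flatMap_range_mul {α : Type*} (f : ℕ → List α) (M : ℕ) : ∀ N : ℕ,
    (List.range (N * M)).flatMap f =
      (List.range N).flatMap fun i => (List.range M).flatMap fun j => f (i * M + j)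
  | 0 => by simp
  | N + 1 => by
    rw [Nat.succ_mul, List.range_add, List.flatMap_append, flatMap_range_mul f M N,
      List.range_succ, List.flatMap_append, List.flatMap_map]
    simp

/-- The heads are at the beginning, except that the rest of the input is `l`. -/
def Reading (l : List Bool) (s : Store) : Prop := s.Clean ∧ ∀ n, s.view 0 n = l.getD n false

variable {N : ℕ} {s : Store} {a : Arr} {rest : List Bool}

theorem reading_of_eq {f : ℕ → Bool} {p : ℕ} (hs : s.Clean) (ha : a ≠ 0)
    (h : ∀ n, s.arr 0 (p + n) = rest.getD n false) :
    Reading rest { s with arr := update s.arr a f, pos := update s.pos 0 p } := by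
  refine ⟨fun b hb => ?_, fun n => ?_⟩
  · simpa [hb] using hs b hb
  · simpa [Store.view, ha.symm] using h n

theorem unary_spec {k : ℕ} (hk : k ≤ N) (ha : a ≠ 0) (hs : s.arr a = fun _ => false)
    (hr : Reading (List.replicate k true ++ false :: rest) s) (env : Ctr → ℕ) :
    Reading rest ((Prog.unary a).eval N env s) ∧
      (∀ i < N, At₁ (((Prog.unary a).eval N env s).arr a) i ↔ i < k) ∧
      ∀ b ≠ a, ((Prog.unary a).eval N env s).arr b = s.arr b := by
  obtain ⟨p, h, h'⟩ := eval_unary ha (hr.1 a ha) hk hs env rest hr.2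
  rw [h]
  exact ⟨reading_of_eq hr.1 ha h', fun i _ => by simp [At₁], fun b hb => by simp [hb]⟩

theorem load₁_spec {n : ℕ} (hn : n ≤ N) {d : Arr} (ha : a ≠ 0) (hd : d ≠ 0) (hda : d ≠ a)
    (hsd : ∀ i < N, At₁ (s.arr d) i ↔ i < n) {f : Fin n → Bool}
    (hr : Reading ((List.finRange n).map f ++ rest) s) (env : Ctr → ℕ) :
    Reading rest ((Prog.load a [0] (.rel d [0])).eval N env s) ∧
      (∀ i < N, At₁ (((Prog.load a [0] (.rel d [0])).eval N env s).arr a) i ↔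
        ∃ h : i < n, f ⟨i, h⟩ = true) ∧
      ∀ b ≠ a, ((Prog.load a [0] (.rel d [0])).eval N env s).arr b = s.arr b := by
  have hv : ∀ i < N, (Fm.rel d [0]).val N s.view (point N env [0] i) = true ↔ i < n := by
    intro i hi
    rw [Fm.val_eq_true, hr.1.sat_iff (by simpa [Fm.arrs] using hd.symm), sat_rel₁]
    simpa [point] using hsd i hi
  obtain ⟨p, h, h'⟩ := eval_load (N := N) (xs := [0]) (φ := .rel d [0])
    (by simpa [Fm.arrs] using hda.symm) (by simpa [Fm.arrs] using hd.symm) ha (hr.1 a ha) env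
    (fun m => if h : m < n then f ⟨m, h⟩ else false) rest (by
      intro m
      rw [hr.2, List.length_singleton, pow_one, flatMap_range_eq hn (g := fun i => [f i])]
      · simp [← List.map_eq_flatMap]
      · intro i
        rw [if_pos ((hv i (i.2.trans_le hn)).2 i.2)]
        simp
      · intro i hi hi'
        rw [if_neg fun h => absurd ((hv i hi).1 h) (by omega)])
  rw [h]
  refine ⟨reading_of_eq hr.1 ha h', fun i hi => ?_, fun b hb => by simp [hb]⟩
  simp only [At₁, update_self, List.length_singleton, pow_one, if_pos hi, Bool.and_eq_true, hv i hi]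
  constructor
  · rintro ⟨h₁, h₂⟩
    exact ⟨h₁, by simpa [h₁] using h₂⟩
  · rintro ⟨h₁, h₂⟩
    exact ⟨h₁, by simpa [h₁] using h₂⟩

theorem load₃_spec {k n : ℕ} (hk : k ≤ N) (hn : n ≤ N) {d : Arr} (ha : a ≠ 0) (hd : d ≠ 0)
    (hda : d ≠ a) (ha1 : a ≠ 1)
    (hsd : ∀ i < N, At₁ (s.arr d) i ↔ i < n) (hs1 : ∀ i < N, At₁ (s.arr 1) i ↔ i < k)
    {f : Fin n → Fin k → Fin n → Bool}
    (hr : Reading (((List.finRange n).flatMap fun p => (List.finRange k).flatMap fun a =>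
      (List.finRange n).map fun q => f p a q) ++ rest) s) (env : Ctr → ℕ) :
    let φ := Fm.and (.rel d [0]) (.and (.rel 1 [1]) (.rel d [2]))
    Reading rest ((Prog.load a [0, 1, 2] φ).eval N env s) ∧
      (∀ i < N, ∀ j < N, ∀ l < N,
        At₃ N (((Prog.load a [0, 1, 2] φ).eval N env s).arr a) i j l ↔
        ∃ (hi : i < n) (hj : j < k) (hl : l < n), f ⟨i, hi⟩ ⟨j, hj⟩ ⟨l, hl⟩ = true) ∧
      ∀ b ≠ a, ((Prog.load a [0, 1, 2] φ).eval N env s).arr b = s.arr b := by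
  intro φ
  have hφ0 : 0 ∉ φ.arrs := by simpa [φ, Fm.arrs] using hd.symm
  have hlt : ∀ i < N, ∀ j < N, ∀ l < N, i * (N * N) + (j * N + l) < N ^ 3 := by
    intro i hi j hj l hl
    have h₁ : j * N + l < N * N := by nlinarith
    have h₂ : (i + 1) * (N * N) ≤ N * (N * N) := Nat.mul_le_mul_right _ hi
    have h₃ : N ^ 3 = N * (N * N) := by ring
    rw [h₃]
    linarith [h₂, (by ring : (i + 1) * (N * N) = i * (N * N) + N * N)]
  have hv : ∀ i < N, ∀ j < N, ∀ l < N,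
      φ.val N s.view (point N env [0, 1, 2] (i * (N * N) + (j * N + l))) = true ↔
        i < n ∧ j < k ∧ l < n := by
    intro i hi j hj l hl
    rw [Fm.val_eq_true, hr.1.sat_iff hφ0, point₃ hj hl]
    simp only [φ, sat_and, sat_rel₁]
    simp [hsd i hi, hs1 j hj, hsd l hl]
  -- `g` recovers the three indices from an address by division in base `N`; its values at improper
  -- addresses are irrelevant, because `φ` fails there.
  set g : ℕ → Bool := fun m => if h : m / (N * N) < n ∧ m % (N * N) / N < k ∧ m % (N * N) % N < n
    then f ⟨_, h.1⟩ ⟨_, h.2.1⟩ ⟨_, h.2.2⟩ else false with hg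
  have hgv : ∀ (i : Fin n) (j : Fin k) (l : Fin n),
      g (i * (N * N) + (j * N + l)) = f i j l := by
    intro i j l
    have hj := j.2.trans_le hk
    have hl := l.2.trans_le hn
    have hjl : (j : ℕ) * N + l < N * N := by nlinarith
    have e₁ : ((i : ℕ) * (N * N) + (j * N + l)) / (N * N) = i := by
      rw [mul_comm, Nat.mul_add_div (by omega), Nat.div_eq_of_lt hjl, add_zero]
    have e₂ : ((i : ℕ) * (N * N) + (j * N + l)) % (N * N) / N = j := by
      rw [Nat.mul_add_mod_of_lt hjl, mul_comm, Nat.mul_add_div (by omega), Nat.div_eq_of_lt hl,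
        add_zero]
    have e₃ : ((i : ℕ) * (N * N) + (j * N + l)) % (N * N) % N = l := by
      rw [Nat.mul_add_mod_of_lt hjl, Nat.mul_add_mod_of_lt hl]
    simp only [hg, e₁, e₂, e₃]
    simp
  obtain ⟨p, h, h'⟩ := eval_load (N := N) (xs := [0, 1, 2]) (φ := φ)
    (by simp [φ, Fm.arrs, hda.symm, ha1]) hφ0 ha (hr.1 a ha) env g rest (by
      intro m
      rw [hr.2]
      congr 2
      have e₃ : N ^ [(0 : Ctr), 1, 2].length = N * (N * N) := show N ^ 3 = _ by ring
      rw [e₃, flatMap_range_mul]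
      symm
      refine flatMap_range_eq hn (fun i => ?_) fun i hi hi' => ?_
      · rw [flatMap_range_mul]
        refine flatMap_range_eq hk (fun j => ?_) fun j hj hj' => ?_
        · rw [flatMap_range_eq hn (g := fun l => [f i j l])]
          · exact List.map_eq_flatMap.symm
          · intro l
            rw [if_pos ((hv _ (i.2.trans_le hn) _ (j.2.trans_le hk) _ (l.2.trans_le hn)).2
              ⟨i.2, j.2, l.2⟩), hgv]
          · intro l hl hl'
            rw [if_neg fun h => absurd ((hv _ (i.2.trans_le hn) _ (j.2.trans_le hk) _ hl).1 h)
              (by omega)]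
        · rw [List.flatMap_eq_nil_iff]
          intro l hl
          rw [if_neg fun h => absurd ((hv _ (i.2.trans_le hn) _ hj _ (List.mem_range.1 hl)).1 h)
              (by omega)]
      · rw [flatMap_range_mul, List.flatMap_eq_nil_iff]
        intro j hj
        rw [List.flatMap_eq_nil_iff]
        intro l hl
        rw [if_neg fun h => absurd ((hv _ hi _ (List.mem_range.1 hj) _ (List.mem_range.1 hl)).1 h)
              (by omega)])
  rw [h]
  refine ⟨reading_of_eq hr.1 ha h', fun i hi j hj l hl => ?_, fun b hb => by simp [hb]⟩
  have hl3 : i * (N * N) + (j * N + l) < N ^ [(0 : Ctr), 1, 2].length := hlt i hi j hj l hl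
  simp only [At₃, update_self, if_pos hl3, Bool.and_eq_true, hv i hi j hj l hl]
  constructor
  · rintro ⟨⟨h₁, h₂, h₃⟩, h₄⟩
    exact ⟨h₁, h₂, h₃, by rw [← hgv]; exact h₄⟩
  · rintro ⟨h₁, h₂, h₃, h₄⟩
    exact ⟨⟨h₁, h₂, h₃⟩, by rw [← hgv] at h₄; exact h₄⟩

/-- Read the input. -/
def readInput : Prog :=
  .seq (.rep 0 (.left 0)) <| .seq (.unary 1) <| .seq (.unary 2) <| .seq (.unary 3) <|
    .seq (.load 4 [0] (.rel 2 [0])) <| .seq (.load 6 [0] (.rel 2 [0])) <|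
    .seq (.load 8 [0, 1, 2] (.and (.rel 2 [0]) (.and (.rel 1 [1]) (.rel 2 [2])))) <|
    .seq (.load 5 [0] (.rel 3 [0])) <| .seq (.load 7 [0] (.rel 3 [0])) <|
    .seq (.load 9 [0, 1, 2] (.and (.rel 3 [0]) (.and (.rel 1 [1]) (.rel 3 [2])))) (.diag 10)

/-- The input head starts behind the last bit, and the first loop takes it back by `N` cells, the
length of the input. Each reading program then consumes its own segment, in the order fixed by
`encodeNFAPair`. -/
theorem readInput_spec {k n₁ n₂ : ℕ} (M₁ : NFA (Fin k) (Fin n₁)) (M₂ : NFA (Fin k) (Fin n₂))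
    (hN : N = (encodeNFAPair M₁ M₂).length) (hk : k ≤ N) (h₁ : n₁ ≤ N) (h₂ : n₂ ≤ N)
    (env : Ctr → ℕ) :
    Loaded N M₁ M₂ (readInput.eval N env (initStore (encodeNFAPair M₁ M₂))) := by
  have hz : ∀ a ≠ 0, (initStore (encodeNFAPair M₁ M₂)).arr a = fun _ => false := by
    intro a ha
    simp [initStore, ha]
  have hl : ∀ s, (Prog.rep 0 (.left 0)).eval N env s =
      { s with pos := update s.pos 0 (s.pos 0 - N) } := by
    intro s
    rw [← iterate_left (N := N) (env := env), ← foldl_range_const]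
    rfl
  simp only [readInput, Prog.eval.eq_8]
  have r₀ : Reading (encodeNFAPair M₁ M₂) ((Prog.rep 0 (.left 0)).eval N env
      (initStore (encodeNFAPair M₁ M₂))) := by
    rw [hl]
    refine ⟨fun a ha => ?_, fun n => ?_⟩
    · simp [initStore, ha]
    · simp [Store.view, initStore, hN]
  have z₀ : ∀ a ≠ 0, ((Prog.rep 0 (.left 0)).eval N env
      (initStore (encodeNFAPair M₁ M₂))).arr a = fun _ => false := by
    rw [hl]; exact hz
  clear hz hl
  generalize (Prog.rep 0 (.left 0)).eval N env (initStore (encodeNFAPair M₁ M₂)) = s₀ at *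
  rw [encodeNFAPair, encodeNFA, encodeNFA] at r₀
  simp only [List.append_assoc, List.cons_append, List.nil_append] at r₀
  obtain ⟨r₁, d₁, f₁⟩ := unary_spec hk (a := 1) (by decide) (z₀ _ (by decide)) r₀ env
  generalize (Prog.unary 1).eval N env s₀ = s₁ at *
  obtain ⟨r₂, d₂, f₂⟩ := unary_spec h₁ (a := 2) (by decide)
    (by rw [f₁ _ (by decide), z₀ _ (by decide)]) r₁ env
  generalize (Prog.unary 2).eval N env s₁ = s₂ at *
  obtain ⟨r₃, d₃, f₃⟩ := unary_spec h₂ (a := 3) (by decide)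
    (by rw [f₂ _ (by decide), f₁ _ (by decide), z₀ _ (by decide)]) r₂ env
  generalize (Prog.unary 3).eval N env s₂ = s₃ at *
  obtain ⟨r₄, d₄, f₄⟩ := load₁_spec h₁ (a := 4) (d := 2) (by decide) (by decide) (by decide)
    (by rw [f₃ _ (by decide)]; exact d₂) r₃ env
  generalize (Prog.load 4 [0] (.rel 2 [0])).eval N env s₃ = s₄ at *
  obtain ⟨r₅, d₅, f₅⟩ := load₁_spec h₁ (a := 6) (d := 2) (by decide) (by decide) (by decide)
    (by rw [f₄ _ (by decide), f₃ _ (by decide)]; exact d₂) r₄ env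
  generalize (Prog.load 6 [0] (.rel 2 [0])).eval N env s₄ = s₅ at *
  obtain ⟨r₆, d₆, f₆⟩ := load₃_spec hk h₁ (a := 8) (d := 2) (by decide) (by decide) (by decide)
    (by decide) (by rw [f₅ _ (by decide), f₄ _ (by decide), f₃ _ (by decide)]; exact d₂)
    (by rw [f₅ _ (by decide), f₄ _ (by decide), f₃ _ (by decide), f₂ _ (by decide)]; exact d₁)
    r₅ env
  generalize (Prog.load 8 [0, 1, 2]
    (.and (.rel 2 [0]) (.and (.rel 1 [1]) (.rel 2 [2])))).eval N env s₅ = s₆ at *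
  obtain ⟨r₇, d₇, f₇⟩ := load₁_spec h₂ (a := 5) (d := 3) (by decide) (by decide) (by decide)
    (by rw [f₆ _ (by decide), f₅ _ (by decide), f₄ _ (by decide)]; exact d₃) r₆ env
  generalize (Prog.load 5 [0] (.rel 3 [0])).eval N env s₆ = s₇ at *
  obtain ⟨r₈, d₈, f₈⟩ := load₁_spec h₂ (a := 7) (d := 3) (by decide) (by decide) (by decide)
    (by rw [f₇ _ (by decide), f₆ _ (by decide), f₅ _ (by decide), f₄ _ (by decide)]; exact d₃)
    r₇ env
  generalize (Prog.load 7 [0] (.rel 3 [0])).eval N env s₇ = s₈ at *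
  -- The last table is followed by an empty rest.
  rw [← List.append_nil (List.flatMap _ _)] at r₈
  obtain ⟨r₉, d₉, f₉⟩ := load₃_spec hk h₂ (a := 9) (d := 3) (by decide) (by decide) (by decide)
    (by decide) (by rw [f₈ _ (by decide), f₇ _ (by decide), f₆ _ (by decide), f₅ _ (by decide),
      f₄ _ (by decide)]; exact d₃)
    (by rw [f₈ _ (by decide), f₇ _ (by decide), f₆ _ (by decide), f₅ _ (by decide),
      f₄ _ (by decide), f₃ _ (by decide), f₂ _ (by decide)]; exact d₁) r₈ env
  generalize (Prog.load 9 [0, 1, 2]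
    (.and (.rel 3 [0]) (.and (.rel 1 [1]) (.rel 3 [2])))).eval N env s₈ = s₉ at *
  obtain ⟨f, hf, heq⟩ := eval_diag (N := N) (a := 10) (r₉.1 _ (by decide)) (by
    rw [f₉ _ (by decide), f₈ _ (by decide), f₇ _ (by decide), f₆ _ (by decide), f₅ _ (by decide),
      f₄ _ (by decide), f₃ _ (by decide), f₂ _ (by decide), f₁ _ (by decide), z₀ _ (by decide)]) env
  have f₁₀ : ∀ b ≠ 10, ((Prog.diag 10).eval N env s₉).arr b = s₉.arr b := by
    rw [hf]; intro b hb; simp [hb]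
  have d₁₀ : ((Prog.diag 10).eval N env s₉).arr 10 = f := by rw [hf]; simp
  have c₁₀ : ((Prog.diag 10).eval N env s₉).Clean := by rw [hf]; exact r₉.1
  generalize (Prog.diag 10).eval N env s₉ = s₁₀ at *
  refine ⟨c₁₀, ?_, ?_, ?_, ?_, ?_, ?_, ?_, ?_, ?_, ?_⟩
  · rw [f₁₀ _ (by decide), f₉ _ (by decide), f₈ _ (by decide), f₇ _ (by decide), f₆ _ (by decide),
      f₅ _ (by decide), f₄ _ (by decide), f₃ _ (by decide), f₂ _ (by decide)]
    exact d₁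
  · rw [f₁₀ _ (by decide), f₉ _ (by decide), f₈ _ (by decide), f₇ _ (by decide), f₆ _ (by decide),
      f₅ _ (by decide), f₄ _ (by decide), f₃ _ (by decide)]
    exact d₂
  · rw [f₁₀ _ (by decide), f₉ _ (by decide), f₈ _ (by decide), f₇ _ (by decide), f₆ _ (by decide),
      f₅ _ (by decide), f₄ _ (by decide)]
    exact d₃
  · rw [f₁₀ _ (by decide), f₉ _ (by decide), f₈ _ (by decide), f₇ _ (by decide), f₆ _ (by decide),
      f₅ _ (by decide)]
    simpa using d₄
  · rw [f₁₀ _ (by decide), f₉ _ (by decide), f₈ _ (by decide)]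
    simpa using d₇
  · rw [f₁₀ _ (by decide), f₉ _ (by decide), f₈ _ (by decide), f₇ _ (by decide), f₆ _ (by decide)]
    simpa using d₅
  · rw [f₁₀ _ (by decide), f₉ _ (by decide)]
    simpa using d₈
  · rw [f₁₀ _ (by decide), f₉ _ (by decide), f₈ _ (by decide), f₇ _ (by decide)]
    simpa [Stores] using d₆
  · rw [f₁₀ _ (by decide)]
    simpa [Stores] using d₉
  · rw [d₁₀]
    exact heq

/-- The algorithm. -/
def algorithm : Prog := .seq readInput decideProg

instance Prog.decidableWF : DecidablePred Prog.WF
  | .seq P Q => @instDecidableAnd _ _ (decidableWF P) (decidableWF Q)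
  | .ite P Q => @instDecidableAnd _ _ (decidableWF P) (decidableWF Q)
  | .rep _ P => @instDecidableAnd _ _ inferInstance (decidableWF P)
  | .times _ P => @instDecidableAnd _ _ inferInstance (decidableWF P)
  | .skip | .const _ | .op _ | .get _ | .put _ | .right _ | .left _ => .isTrue trivial

/-- A finite syntactic check: the counters for tuples and quantifiers, the round counters `8` and
`9`, and the counters reserved by `power` do not clash. -/
theorem wf_algorithm : algorithm.WF := by
  decide +kernel

theorem length_encodeNFA {k n : ℕ} (M : NFA (Fin k) (Fin n)) :
    (encodeNFA M).length = n + n + n * (k * n) := by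
  simp [encodeNFA, List.length_flatMap, add_assoc]

theorem length_encodeNFAPair {k n₁ n₂ : ℕ} (M₁ : NFA (Fin k) (Fin n₁)) (M₂ : NFA (Fin k) (Fin n₂)) :
    (encodeNFAPair M₁ M₂).length = k + 1 + (n₁ + 1) + (n₂ + 1) + (n₁ + n₁ + n₁ * (k * n₁)) +
      (n₂ + n₂ + n₂ * (k * n₂)) := by
  simp only [encodeNFAPair, List.length_append, List.length_replicate, List.length_cons,
    List.length_nil, length_encodeNFA]

/-- The running time of the algorithm. -/
noncomputable def runTime : Polynomial ℕ :=
  (2 * Polynomial.X + 2 * algorithm.cost + 3).comp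
    (3 + 3 * Polynomial.X + 2 * Polynomial.X ^ 3)

end LoopProg

/-- There are one multi-stack Turing machine `T` (with finite stack alphabets) and one polynomial `time` such that, on every pair
of NFAs with `n₁` and `n₂` states over a common alphabet of size `k`, the machine `T` halts within
`time (n₁ + n₂ + k)` steps and outputs whether both NFAs admit a path of a common factorization
pattern. -/
theorem mainTheorem3 :
    ∃ (T : Turing.TM2ComputableAux Bool Bool) (time : Polynomial ℕ),
      (∀ j, Finite (T.tm.Γ j)) ∧
      ∀ (k n₁ n₂ : ℕ) (M₁ : NFA (Fin k) (Fin n₁)) (M₂ : NFA (Fin k) (Fin n₂)),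
        Nonempty (Turing.TM2OutputsInTime T.tm
          ((encodeNFAPair M₁ M₂).map T.inputAlphabet.symm)
          (some ((Computability.encodeBool (hasCommonPatternPath M₁ M₂)).map
            T.outputAlphabet.symm))
          (time.eval (n₁ + n₂ + k))) := by
  refine ⟨⟨LoopProg.machine LoopProg.algorithm, Equiv.refl Bool, Equiv.refl Bool⟩,
    LoopProg.runTime, fun _ => inferInstanceAs (Finite Bool), fun k n₁ n₂ M₁ M₂ => ?_⟩
  obtain ⟨h⟩ := LoopProg.machine_outputs _ LoopProg.wf_algorithm (encodeNFAPair M₁ M₂)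
  have hlen := LoopProg.length_encodeNFAPair M₁ M₂
  have hspec := LoopProg.decideProg_spec (N := (encodeNFAPair M₁ M₂).length) (by omega) (by omega)
    (by omega) (LoopProg.readInput_spec M₁ M₂ rfl (by omega) (by omega) (by omega) fun _ => 0)
    fun _ => 0
  have hres : (LoopProg.algorithm.eval (encodeNFAPair M₁ M₂).length (fun _ => 0)
      (LoopProg.initStore (encodeNFAPair M₁ M₂))).bst.headD false =
      hasCommonPatternPath M₁ M₂ := by
    rw [LoopProg.algorithm, LoopProg.Prog.eval]
    exact hspec
  rw [hres] at h
  have htime : 2 * (encodeNFAPair M₁ M₂).length +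
      2 * LoopProg.algorithm.cost.eval (encodeNFAPair M₁ M₂).length + 3 ≤
      LoopProg.runTime.eval (n₁ + n₂ + k) := by
    -- The two transition tables account for the cubic terms; the three separators, the unary
    -- numbers and the four characteristic vectors account for the rest.
    have hle : (encodeNFAPair M₁ M₂).length ≤
        3 + 3 * (n₁ + n₂ + k) + 2 * (n₁ + n₂ + k) ^ 3 := by
      have b₁ : n₁ * (k * n₁) ≤ (n₁ + n₂ + k) * ((n₁ + n₂ + k) * (n₁ + n₂ + k)) :=
        Nat.mul_le_mul (by omega) (Nat.mul_le_mul (by omega) (by omega))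
      have b₂ : n₂ * (k * n₂) ≤ (n₁ + n₂ + k) * ((n₁ + n₂ + k) * (n₁ + n₂ + k)) :=
        Nat.mul_le_mul (by omega) (Nat.mul_le_mul (by omega) (by omega))
      rw [hlen, show (n₁ + n₂ + k) ^ 3 = (n₁ + n₂ + k) * ((n₁ + n₂ + k) * (n₁ + n₂ + k)) by ring]
      omega
    have := LoopProg.eval_le_eval (2 * Polynomial.X + 2 * LoopProg.algorithm.cost + 3) hle
    simp only [Polynomial.eval_add, Polynomial.eval_mul, Polynomial.eval_X,
      Polynomial.eval_ofNat] at this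
    refine this.trans (le_of_eq ?_)
    simp [LoopProg.runTime, Polynomial.eval_comp]
  have h' : Turing.TM2OutputsInTime (LoopProg.machine LoopProg.algorithm)
      ((encodeNFAPair M₁ M₂).map id) (some ([hasCommonPatternPath M₁ M₂].map id))
      (LoopProg.runTime.eval (n₁ + n₂ + k)) := by
    erw [List.map_id, List.map_id]
    exact ⟨h.toEvalsTo, h.steps_le_m.trans htime⟩
  exact ⟨h'⟩
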